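/- For an $n\times m$ real matrix $A$ with $m,n\ge 1$ and nonzero rows $a_1,\dots,a_n\in\mathbb{R}^m$, and for $x\in\mathbb{R}^m\setminus\{0\}$, let $\theta_i(A,x)=\arccos\frac{a_i\cdot x}{\|a_i\|\,\|x\|}\in[0,\pi]$ be the angle between $a_i$ and $x$. Put $$\theta(A)=\sup_{x\in\mathbb{R}^m\setminus\{0\}}\ \min_{1\le i\le n}\theta_i(A,x),\qquad \mathscr{C}(A)=|\cos\theta(A)|^{-1}\in[1,\infty],$$ with $\mathscr{C}(A)=\infty$ if $\cos\theta(A)=0$. For all integers $m,n$ with $1\le m\le n$ let $A^{[m,n]}$ be a uniform random $n\times m$ matrix, that is, a random matrix whose $n$ rows are independent and uniformly distributed on the unit sphere $\mathrm{S}^{m-1}$ of $\mathbb{R}^m$ (the matrices for different $(m,n)$ may be defined on different probability spaces). Then $$\limsup_{m\to\infty}\ \sup_{n\ge m}\ \frac{\mathbf{E}\bigl[\log\mathscr{C}(A^{[m,n]})\bigr]}{m}\ \le\ \log 2,$$ where $\log$ is the natural logarithm and the expectations take values in $[0,\infty]$. -/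

import Mathlib

open MeasureTheory ProbabilityTheory Filter
open scoped ENNReal

namespace LinearFeasibility

noncomputable section

/-- The `i`-th row of `A`, as a vector of Euclidean space. -/
def rowVec {n m : ℕ} (A : Matrix (Fin n) (Fin m) ℝ) (i : Fin n) : EuclideanSpace ℝ (Fin m) :=
  WithLp.toLp 2 (A i)

/-- `θ(A, x) = min_i θ_i(A, x)`, where `θ_i(A, x) ∈ [0, π]` is the angle between the `i`-th row
of `A` and `x`. -/
def thetaAt {n m : ℕ} (A : Matrix (Fin n) (Fin m) ℝ) (x : EuclideanSpace ℝ (Fin m)) : ℝ :=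
  ⨅ i : Fin n, InnerProductGeometry.angle (rowVec A i) x

/-- `θ(A) = sup_{x ≠ 0} θ(A, x)`. -/
def theta {n m : ℕ} (A : Matrix (Fin n) (Fin m) ℝ) : ℝ :=
  ⨆ x : {x : EuclideanSpace ℝ (Fin m) // x ≠ 0}, thetaAt A x

/-- The condition number `𝒞(A) = |cos θ(A)|⁻¹ ∈ [1, ∞]`; it is `∞` when `cos θ(A) = 0`, that is,
for ill-posed `A`. -/
def conditionNumber {n m : ℕ} (A : Matrix (Fin n) (Fin m) ℝ) : ℝ≥0∞ :=
  (ENNReal.ofReal |Real.cos (theta A)|)⁻¹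

/-- `log 𝒞(A) ∈ [0, ∞]`. Since `𝒞(A) ≥ 1`, the conversion from the extended reals to `[0, ∞]`
loses nothing, see `coe_logConditionNumber`. -/
def logConditionNumber {n m : ℕ} (A : Matrix (Fin n) (Fin m) ℝ) : ℝ≥0∞ :=
  (ENNReal.log (conditionNumber A)).toENNReal

/-- The uniform probability measure on the unit sphere of `ℝ^m` (for `1 ≤ m`): the normalized
surface measure. -/
def uniformSphere (m : ℕ) : Measure (Metric.sphere (0 : EuclideanSpace ℝ (Fin m)) 1) :=
  ((volume : Measure (EuclideanSpace ℝ (Fin m))).toSphere Set.univ)⁻¹ •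
    (volume : Measure (EuclideanSpace ℝ (Fin m))).toSphere

/-- `A` is a uniform random `n × m` matrix on the probability space `(Ω, P)`: its rows are
independent random vectors, each uniformly distributed on the unit sphere of `ℝ^m`. -/
structure IsUniformRandomMatrix {Ω : Type*} [MeasurableSpace Ω] {n m : ℕ}
    (A : Ω → Matrix (Fin n) (Fin m) ℝ) (P : Measure Ω) : Prop where
  hasLaw_row : ∀ i : Fin n,
    HasLaw (fun ω => rowVec (A ω) i) ((uniformSphere m).map Subtype.val) P
  indep_rows : iIndepFun (fun (i : Fin n) ω => rowVec (A ω) i) P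

/-- The expectation `E[log 𝒞(A)] ∈ [0, ∞]`. -/
def expectedLogConditionNumber {Ω : Type*} [MeasurableSpace Ω] {n m : ℕ}
    (A : Ω → Matrix (Fin n) (Fin m) ℝ) (P : Measure Ω) : ℝ≥0∞ :=
  ∫⁻ ω, logConditionNumber (A ω) ∂P

theorem coe_logConditionNumber {n m : ℕ} (A : Matrix (Fin n) (Fin m) ℝ) :
    ((logConditionNumber A : ℝ≥0∞) : EReal) = ENNReal.log (conditionNumber A) := by
  refine EReal.coe_toENNReal ?_
  rw [ENNReal.zero_le_log_iff, conditionNumber, ENNReal.one_le_inv]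
  simpa using Real.abs_cos_le_one (theta A)

theorem isProbabilityMeasure_uniformSphere {m : ℕ} (hm : 1 ≤ m) :
    IsProbabilityMeasure (uniformSphere m) := by
  have : Nonempty (Fin m) := ⟨⟨0, hm⟩⟩
  have : Nontrivial (EuclideanSpace ℝ (Fin m)) := inferInstance
  refine ⟨?_⟩
  rw [uniformSphere, Measure.smul_apply, smul_eq_mul]
  exact ENNReal.inv_mul_cancel
    (fun h => Measure.toSphere_ne_zero _ (Measure.measure_univ_eq_zero.1 h)) (measure_ne_top _ _)

theorem continuous_angle_right {m : ℕ} (a : EuclideanSpace ℝ (Fin m)) :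
    Continuous fun x : {x : EuclideanSpace ℝ (Fin m) // x ≠ 0} =>
      InnerProductGeometry.angle a (x : EuclideanSpace ℝ (Fin m)) := by
  by_cases ha : a = 0
  · subst ha
    simp only [InnerProductGeometry.angle_zero_left]
    exact continuous_const
  · rw [continuous_iff_continuousAt]
    intro x
    exact (InnerProductGeometry.continuousAt_angle (x := (a, (x : EuclideanSpace ℝ (Fin m))))
      ha x.2).comp (f := fun x : {x : EuclideanSpace ℝ (Fin m) // x ≠ 0} =>
        (a, (x : EuclideanSpace ℝ (Fin m)))) (by fun_prop)

theorem continuous_thetaAt {n m : ℕ} (hn : 1 ≤ n) (A : Matrix (Fin n) (Fin m) ℝ) :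
    Continuous fun x : {x : EuclideanSpace ℝ (Fin m) // x ≠ 0} => thetaAt A x := by
  have : Nonempty (Fin n) := ⟨⟨0, hn⟩⟩
  have h : (fun x : {x : EuclideanSpace ℝ (Fin m) // x ≠ 0} => thetaAt A x) =
      fun (x : {x : EuclideanSpace ℝ (Fin m) // x ≠ 0}) => Finset.univ.inf' Finset.univ_nonempty
        (fun i => InnerProductGeometry.angle (rowVec A i) (x : EuclideanSpace ℝ (Fin m))) := by
    funext x
    simp only [thetaAt, Finset.inf'_univ_eq_ciInf]
  rw [h]
  exact Continuous.finset_inf'_apply _ fun i _ => continuous_angle_right _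

theorem thetaAt_le_pi {n m : ℕ} (hn : 1 ≤ n) (A : Matrix (Fin n) (Fin m) ℝ)
    (x : EuclideanSpace ℝ (Fin m)) : thetaAt A x ≤ Real.pi :=
  (ciInf_le (Set.finite_range _).bddBelow (⟨0, hn⟩ : Fin n)).trans
    (InnerProductGeometry.angle_le_pi _ _)

/-- The integrand in `expectedLogConditionNumber` is measurable. -/
theorem aemeasurable_logConditionNumber {Ω : Type*} [MeasurableSpace Ω] {n m : ℕ}
    (hm : 1 ≤ m) (hn : 1 ≤ n) {A : Ω → Matrix (Fin n) (Fin m) ℝ} {P : Measure Ω}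
    (hA : ∀ i, AEMeasurable (fun ω => rowVec (A ω) i) P) :
    AEMeasurable (fun ω => logConditionNumber (A ω)) P := by
  have : Nonempty (Fin m) := ⟨⟨0, hm⟩⟩
  have : Nonempty {x : EuclideanSpace ℝ (Fin m) // x ≠ 0} :=
    let ⟨x, hx⟩ := exists_ne (0 : EuclideanSpace ℝ (Fin m)); ⟨⟨x, hx⟩⟩
  obtain ⟨u, hu⟩ := TopologicalSpace.exists_dense_seq
    {x : EuclideanSpace ℝ (Fin m) // x ≠ 0}
  have hth : ∀ B : Matrix (Fin n) (Fin m) ℝ, theta B = ⨆ k : ℕ, thetaAt B (u k) := by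
    intro B
    have hb : BddAbove (Set.range fun k : ℕ => thetaAt B (u k)) :=
      ⟨Real.pi, by rintro _ ⟨k, rfl⟩; exact thetaAt_le_pi hn B _⟩
    apply le_antisymm
    · refine ciSup_le fun x => ?_
      have hc : IsClosed {x : {x : EuclideanSpace ℝ (Fin m) // x ≠ 0} |
          thetaAt B x ≤ ⨆ k : ℕ, thetaAt B (u k)} :=
        isClosed_le (continuous_thetaAt hn B) continuous_const
      exact hu.induction_on (p := fun x => thetaAt B x ≤ ⨆ k : ℕ, thetaAt B (u k)) x hc
        (fun k => le_ciSup hb k)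
    · exact ciSup_le fun k => le_ciSup
        (f := fun x : {x : EuclideanSpace ℝ (Fin m) // x ≠ 0} => thetaAt B x)
        ⟨Real.pi, by rintro _ ⟨x, rfl⟩; exact thetaAt_le_pi hn B _⟩ (u k)
  have hmeas : AEMeasurable (fun ω => theta (A ω)) P := by
    simp only [hth, thetaAt]
    refine AEMeasurable.iSup fun k => AEMeasurable.iInf fun i => ?_
    simp only [InnerProductGeometry.angle]
    have := hA i
    refine Real.measurable_arccos.comp_aemeasurable (AEMeasurable.div ?_ ?_)
    · exact this.inner aemeasurable_const
    · exact this.norm.mul_const _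
  unfold logConditionNumber conditionNumber
  have h1 : AEMeasurable (fun ω => (ENNReal.ofReal |Real.cos (theta (A ω))|)⁻¹) P :=
    ((Real.continuous_cos.abs.measurable.comp_aemeasurable hmeas).ennreal_ofReal).inv
  exact measurable_ereal_toENNReal.comp_aemeasurable
    (ENNReal.measurable_log.comp_aemeasurable h1)

end

end LinearFeasibility

/-! The expectation is in fact O(log m) uniformly in n ≥ m, so any positive constant could replace
log 2. Two estimates are combined according to whether n ≤ m³ or n ≥ m³.

For every n ≥ m the tail satisfies P(log 𝒞 > τ) ≤ 54 n⁶ exp(-τ/2), which gives an expectation O(log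
n). The deterministic input is `exists_margin_or`. Take as events that some row is outside, but
within δ of, the cone generated by the negatives of other rows, or that it is in the closure of such
a cone but a step ±δ along a coordinate axis leaves that closure. If none of these events occurs,
the system is feasible or infeasible with margin of order δ²/n², and 𝒞 is at most the inverse of
that margin.

Each event concerns one row and a cone that does not depend on this row, so by Fubini it suffices to
bound the uniform measure of a neighbourhood of the boundary of a fixed convex cone. By homogeneity
the sphere may be replaced by the ball. There `ballMeasure_convex_exit_le` applies: the points that
one step of length δ takes out of a convex set have pairwise disjoint translates by multiples of the
step, and about 1/(mδ) of these fit into a ball of radius 1 + 1/m, whose volume is at most 3 times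
that of the unit ball.

For n ≥ m³ the tail alone does not suffice, since log n is unbounded for fixed m. But then a net of
(O(m²))^m grid points shows that, outside an event of probability at most (145 m²)^m (3/4)^n, every
direction x has a row with inner product at least 1/(72m), hence log 𝒞 ≤ log(72m). The tail bound
controls the integral over the exceptional event, whose probability absorbs the factor log n. -/

namespace LinearFeasibility

/-! ### Uniform measures on the ball and the sphere. -/

/-- Euclidean space `ℝ^m`. -/
abbrev Euc (m : ℕ) : Type := EuclideanSpace ℝ (Fin m)

/-- The uniform probability measure on the unit ball of `ℝ^m`. -/
noncomputable def ballMeasure (m : ℕ) : Measure (Euc m) :=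
  ProbabilityTheory.cond volume (Metric.ball (0 : Euc m) 1)

/-- The uniform law on the unit sphere, as a measure on `ℝ^m`. -/
noncomputable def sphereLaw (m : ℕ) : Measure (Euc m) :=
  (uniformSphere m).map Subtype.val

instance isProbabilityMeasure_ballMeasure (m : ℕ) : IsProbabilityMeasure (ballMeasure m) :=
  cond_isProbabilityMeasure_of_finite (Metric.measure_ball_pos volume _ one_pos).ne'
    measure_ball_lt_top.ne

theorem isProbabilityMeasure_sphereLaw {m : ℕ} (hm : 1 ≤ m) :
    IsProbabilityMeasure (sphereLaw m) :=
  have := isProbabilityMeasure_uniformSphere hm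
  Measure.isProbabilityMeasure_map measurable_subtype_coe.aemeasurable

theorem ballMeasure_apply {m : ℕ} (T : Set (Euc m)) :
    ballMeasure m T = (volume (Metric.ball (0 : Euc m) 1))⁻¹ *
      volume (Metric.ball (0 : Euc m) 1 ∩ T) :=
  cond_apply measurableSet_ball _ _

theorem sphereLaw_ae_norm {m : ℕ} : ∀ᵐ u ∂(sphereLaw m), ‖u‖ = 1 := by
  rw [sphereLaw, ae_map_iff measurable_subtype_coe.aemeasurable
    (measurableSet_eq_fun measurable_norm measurable_const)]
  exact Eventually.of_forall fun x => by simp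

/-- Polar coordinates: the sphere measure of `S` is the proportion of the ball filled by the
truncated cone over `S`, and the hypothesis puts this cone inside `T`. -/
theorem sphereLaw_le_ballMeasure {m : ℕ} (hm : 1 ≤ m) {S T : Set (Euc m)} (hS : MeasurableSet S)
    (h : ∀ u ∈ S, ‖u‖ = 1 → ∀ r ∈ Set.Ioo (0 : ℝ) 1, r • u ∈ T) :
    sphereLaw m S ≤ ballMeasure m T := by
  have hm0 : (m : ℝ≥0∞) ≠ 0 := by simp; omega
  rw [sphereLaw, Measure.map_apply measurable_subtype_coe hS, uniformSphere, Measure.smul_apply,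
    smul_eq_mul, Measure.toSphere_apply_univ,
    Measure.toSphere_apply' _ (measurable_subtype_coe hS), ballMeasure_apply,
    finrank_euclideanSpace_fin, ENNReal.mul_inv (Or.inl hm0) (Or.inl (ENNReal.natCast_ne_top m)),
    mul_mul_mul_comm, mul_comm _ (m : ℝ≥0∞)]
  rw [ENNReal.mul_inv_cancel hm0 (ENNReal.natCast_ne_top m), one_mul]
  refine mul_le_mul_right (measure_mono ?_) _
  rintro _ ⟨r, hr, _, ⟨u, hu, rfl⟩, rfl⟩
  have hn : ‖(u : Euc m)‖ = 1 := by simp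
  refine ⟨?_, h _ hu hn r hr⟩
  simp only [Metric.mem_ball, dist_zero_right]
  rw [norm_smul, hn, Real.norm_of_nonneg hr.1.le, mul_one]
  exact hr.2

/-! ### Volume near the boundary of a convex set. -/

theorem one_add_inv_pow_le_three (m : ℕ) (hm : 1 ≤ m) : (1 + 1 / (m : ℝ)) ^ m ≤ 3 := by
  have hm0 : (0 : ℝ) < m := by exact_mod_cast hm
  calc (1 + 1 / (m : ℝ)) ^ m ≤ (Real.exp (1 / m)) ^ m := by
        gcongr
        linarith [Real.add_one_le_exp (1 / (m : ℝ))]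
    _ = Real.exp 1 := by rw [← Real.exp_nat_mul]; field_simp
    _ ≤ 3 := Real.exp_one_lt_three.le

/-- The part of a convex set from which a step of length at most `δ` leaves the set is small. -/
theorem ballMeasure_convex_exit_le {m : ℕ} (hm : 1 ≤ m) {K : Set (Euc m)} (hK : Convex ℝ K)
    (hKm : MeasurableSet K) {e : Euc m} (he : ‖e‖ ≤ 1) {δ : ℝ} (hδ : 0 < δ) :
    ballMeasure m {x | x ∈ K ∧ x + δ • e ∉ K} ≤ ENNReal.ofReal (3 * m * δ) := by
  have hm0 : (0 : ℝ) < m := by exact_mod_cast hm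
  set B := Metric.ball (0 : Euc m) 1 with hB
  set T := B ∩ {x | x ∈ K ∧ x + δ • e ∉ K} with hT
  have hTm : MeasurableSet T :=
    measurableSet_ball.inter (hKm.inter ((measurable_add_const _) hKm).compl)
  -- The largest number of translates by 0, δ, 2δ, … whose shifts stay within 1/m; the extra 1 makes
  -- N·mδ ≥ 1.
  set N := ⌊1 / (m * δ)⌋₊ + 1 with hN
  have hN1 : 1 ≤ (m * δ) * N := by
    have := Nat.lt_floor_add_one (1 / (m * δ))
    rw [div_lt_iff₀ (by positivity)] at this
    push_cast [hN]; linarith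
  have hN2 : ∀ j < N, (j : ℝ) * δ ≤ 1 / m := by
    intro j hj
    have h1 : (j : ℝ) ≤ ⌊1 / (m * δ)⌋₊ := by exact_mod_cast Nat.lt_succ_iff.1 hj
    have h2 := Nat.floor_le (by positivity : 0 ≤ 1 / (m * δ))
    calc (j : ℝ) * δ ≤ 1 / (m * δ) * δ := by gcongr; linarith
      _ = 1 / m := by field_simp
  let S : ℕ → Set (Euc m) := fun j => (fun x => x + (-((j * δ) • e))) ⁻¹' T
  have hSm : ∀ j, MeasurableSet (S j) := fun j => (measurable_add_const _) hTm
  have hSv : ∀ j, volume (S j) = volume T := fun j => measure_preimage_add_right _ _ _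
  -- A common point would give `p` and `p + (j - i)δe` in `K`, hence by convexity `p + δe` in `K`,
  -- although `p` exits in one step.
  have hdisj : ∀ i j : ℕ, i < j → Disjoint (S i) (S j) := by
    intro i j hij
    rw [Set.disjoint_left]
    rintro x ⟨-, hx1, -⟩ ⟨-, hx2, hx3⟩
    apply hx3
    have hij' : (0 : ℝ) < j - i := by rw [sub_pos]; exact_mod_cast hij
    have hij1 : (1 : ℝ) ≤ j - i := by
      have : (i : ℝ) + 1 ≤ j := by exact_mod_cast hij
      linarith
    set p := x + -((j * δ) • e) with hp
    have hq : x + -((i * δ) • e) = p + (((j - i : ℝ)) * δ) • e := by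
      rw [hp]; module
    simp only [] at hx1
    rw [hq] at hx1
    have := hK.add_smul_mem hx2 hx1 (t := ((j : ℝ) - i)⁻¹)
      ⟨by positivity, inv_le_one_of_one_le₀ hij1⟩
    rwa [smul_smul, inv_mul_cancel_left₀ hij'.ne'] at this
  have hsub : (⋃ j ∈ Finset.range N, S j) ⊆ Metric.ball 0 (1 + 1 / m) := by
    intro x hx
    simp only [Set.mem_iUnion, Finset.mem_range] at hx
    obtain ⟨j, hj, hx, -⟩ := hx
    simp only [hB, Metric.mem_ball, dist_zero_right] at hx ⊢
    have hj2 := hN2 j hj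
    have h3 : ‖(j * δ) • e‖ ≤ 1 / m := by
      rw [norm_smul, Real.norm_of_nonneg (by positivity)]
      calc (j : ℝ) * δ * ‖e‖ ≤ j * δ * 1 := by gcongr
        _ ≤ _ := by linarith
    calc ‖x‖ = ‖(x + -((j * δ) • e)) + (j * δ) • e‖ := by congr 1; module
      _ ≤ _ := norm_add_le _ _
      _ < _ := by linarith
  have hmain : (N : ℝ≥0∞) * volume T ≤ 3 * volume B := by
    calc (N : ℝ≥0∞) * volume T = ∑ j ∈ Finset.range N, volume (S j) := by simp [hSv]
      _ = volume (⋃ j ∈ Finset.range N, S j) := by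
          refine (measure_biUnion_finset ?_ fun j _ => hSm j).symm
          intro i _ j _ hij
          rcases lt_or_gt_of_ne hij with h | h
          · exact hdisj i j h
          · exact (hdisj j i h).symm
      _ ≤ volume (Metric.ball (0 : Euc m) (1 + 1 / m)) := measure_mono hsub
      _ = ENNReal.ofReal ((1 + 1 / m) ^ m) * volume B := by
          rw [Measure.addHaar_ball_of_pos _ _ (by positivity), finrank_euclideanSpace_fin]
      _ ≤ 3 * volume B := by
          gcongr
          rw [show (3 : ℝ≥0∞) = ENNReal.ofReal 3 by simp]
          exact ENNReal.ofReal_le_ofReal (one_add_inv_pow_le_three m hm)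
  have hB0 : volume B ≠ 0 := (Metric.measure_ball_pos volume _ one_pos).ne'
  have hBt : volume B ≠ ⊤ := measure_ball_lt_top.ne
  rw [ballMeasure_apply]
  calc (volume B)⁻¹ * volume T ≤ (volume B)⁻¹ * (ENNReal.ofReal (m * δ) * (N * volume T)) := by
        gcongr
        rw [← mul_assoc, ← ENNReal.ofReal_natCast, ← ENNReal.ofReal_mul (by positivity)]
        exact le_mul_of_one_le_left' (by simpa using ENNReal.ofReal_le_ofReal hN1)
    _ ≤ (volume B)⁻¹ * (ENNReal.ofReal (m * δ) * (3 * volume B)) := by gcongr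
    _ = ENNReal.ofReal (m * δ) * 3 * ((volume B)⁻¹ * volume B) := by ring
    _ = ENNReal.ofReal (3 * m * δ) := by
        rw [ENNReal.inv_mul_cancel hB0 hBt, mul_one, show (3 : ℝ≥0∞) = ENNReal.ofReal 3 by simp,
          ← ENNReal.ofReal_mul (by positivity)]
        congr 1; ring

/-- Every nonzero vector has a signed coordinate direction along which it has a large component. -/
theorem exists_signed_coordinate {m : ℕ} (hm : 1 ≤ m) (v : Euc m) :
    ∃ (k : Fin m) (b : ℤˣ),
      ‖v‖ / Real.sqrt m ≤ inner ℝ v (((b : ℤ) : ℝ) • EuclideanSpace.single k (1 : ℝ)) := by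
  have : Nonempty (Fin m) := ⟨⟨0, hm⟩⟩
  have hm0 : (0 : ℝ) < m := by exact_mod_cast hm
  obtain ⟨k, hk⟩ : ∃ k, ‖v‖ / Real.sqrt m ≤ |v k| := by
    by_contra! h
    have h1 : ∑ k, (v k) ^ 2 < ∑ _k : Fin m, ‖v‖ ^ 2 / m := by
      refine Finset.sum_lt_sum_of_nonempty Finset.univ_nonempty fun k _ => ?_
      rw [← sq_abs, show ‖v‖ ^ 2 / m = (‖v‖ / Real.sqrt m) ^ 2 by rw [div_pow, Real.sq_sqrt hm0.le]]
      exact pow_lt_pow_left₀ (h k) (abs_nonneg _) two_ne_zero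
    have h2 : ‖v‖ ^ 2 = ∑ k, (v k) ^ 2 := by
      rw [EuclideanSpace.norm_sq_eq]; simp
    rw [← h2] at h1
    simp only [Finset.sum_const, Finset.card_univ, Fintype.card_fin, nsmul_eq_mul] at h1
    rw [mul_div_cancel₀ _ hm0.ne'] at h1
    exact lt_irrefl _ h1
  refine ⟨k, if 0 ≤ v k then 1 else -1, hk.trans ?_⟩
  split_ifs with h
  · simp [EuclideanSpace.inner_single_right, abs_of_nonneg h]
  · simp [EuclideanSpace.inner_single_right, abs_of_neg (not_le.1 h)]

theorem norm_signed_coordinate {m : ℕ} (k : Fin m) (b : ℤˣ) :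
    ‖((b : ℤ) : ℝ) • (EuclideanSpace.single k (1 : ℝ) : Euc m)‖ = 1 := by
  rcases Int.units_eq_one_or b with rfl | rfl <;> simp

/-- The outer neighbourhood of a convex set is small. -/
theorem ballMeasure_thickening_sdiff_le {m : ℕ} (hm : 1 ≤ m) {C : Set (Euc m)} (hC : Convex ℝ C)
    (hne : C.Nonempty) {s : ℝ} (hs : 0 < s) :
    ballMeasure m {x | 0 < Metric.infDist x C ∧ Metric.infDist x C ≤ s} ≤
      ENNReal.ofReal (6 * m ^ 3 * s) := by
  have hm0 : (0 : ℝ) < m := by exact_mod_cast hm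
  have hm1 : (1 : ℝ) ≤ m := by exact_mod_cast hm
  have hsm : 0 < Real.sqrt m := Real.sqrt_pos.2 hm0
  -- Some signed axis makes an inner product of at least 1/√m with any unit normal, so a step s√m
  -- along it advances by at least s in the normal direction.
  set δ := s * Real.sqrt m with hδ
  have hδ0 : 0 < δ := by positivity
  let K := Metric.cthickening s C
  have hKmem : ∀ x, x ∈ K ↔ Metric.infDist x C ≤ s := fun x => by
    rw [Metric.mem_cthickening_iff, Metric.infDist,
      ENNReal.le_ofReal_iff_toReal_le (Metric.infEDist_ne_top hne) hs.le]
  let D : Fin m × ℤˣ → Euc m := fun p => ((p.2 : ℤ) : ℝ) • EuclideanSpace.single p.1 (1 : ℝ)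
  have hsub : {x | 0 < Metric.infDist x C ∧ Metric.infDist x C ≤ s} ⊆
      ⋃ p : Fin m × ℤˣ, {x | x ∈ K ∧ x + δ • D p ∉ K} := by
    rintro x ⟨hx0, hxs⟩
    have hdisj : Disjoint (Metric.ball x (Metric.infDist x C)) C := Metric.disjoint_ball_infDist
    obtain ⟨f, u, hf1, hf2⟩ := geometric_hahn_banach_open (convex_ball _ _) Metric.isOpen_ball
      hC hdisj
    set v := (InnerProductSpace.toDual ℝ (Euc m)).symm f with hv
    have hfv : ∀ y, f y = inner ℝ v y := fun y => by simp [hv]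
    have hxu : f x < u := hf1 x (Metric.mem_ball_self hx0)
    obtain ⟨b₀, hb₀⟩ := hne
    have hv0 : 0 < ‖v‖ := by
      rw [norm_pos_iff]
      intro h0
      have h1 := hf2 _ hb₀
      rw [hfv, h0, inner_zero_left] at h1
      rw [hfv, h0, inner_zero_left] at hxu
      linarith
    obtain ⟨k, b, hkb⟩ := exists_signed_coordinate hm v
    refine Set.mem_iUnion.2 ⟨(k, -b), (hKmem x).2 hxs, ?_⟩
    rw [hKmem, not_le]
    have hD : D (k, -b) = -(((b : ℤ) : ℝ) • EuclideanSpace.single k (1 : ℝ)) := by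
      simp [D]
    set w := ((b : ℤ) : ℝ) • (EuclideanSpace.single k (1 : ℝ) : Euc m) with hw
    -- The step moves away from the separating hyperplane by at least s. The surplus (u - f x)/‖v‖ >
    -- 0, the initial distance to the hyperplane, makes the final distance strictly larger than s.
    have hlow : s + (u - f x) / ‖v‖ ≤ Metric.infDist (x + δ • D (k, -b)) C := by
      rw [Metric.le_infDist ⟨b₀, hb₀⟩]
      intro y hy
      have h1 : u - f x + δ * (‖v‖ / Real.sqrt m) ≤ inner ℝ v (y - (x + δ • D (k, -b))) := by
        rw [hD, inner_sub_right, inner_add_right, inner_smul_right, inner_neg_right, ← hfv, ← hfv]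
        have := mul_le_mul_of_nonneg_left hkb hδ0.le
        linarith [hf2 y hy]
      have h2 : δ * (‖v‖ / Real.sqrt m) = s * ‖v‖ := by rw [hδ]; field_simp
      have h3 := real_inner_le_norm v (y - (x + δ • D (k, -b)))
      rw [dist_comm, dist_eq_norm, ← mul_le_mul_iff_right₀ hv0]
      calc _ = u - f x + s * ‖v‖ := by field_simp; ring
        _ ≤ _ := by linarith
    have : 0 < (u - f x) / ‖v‖ := div_pos (by linarith) hv0
    linarith
  have hcard : Fintype.card (Fin m × ℤˣ) = 2 * m := by
    rw [Fintype.card_prod, Fintype.card_fin, Fintype.card_units_int, mul_comm]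
  calc _ ≤ _ := measure_mono hsub
    _ ≤ ∑ p : Fin m × ℤˣ, ballMeasure m {x | x ∈ K ∧ x + δ • D p ∉ K} :=
        measure_iUnion_fintype_le _ _
    _ ≤ ∑ p : Fin m × ℤˣ, ENNReal.ofReal (3 * m * δ) := by
        gcongr with p
        exact ballMeasure_convex_exit_le hm (hC.cthickening s)
          Metric.isClosed_cthickening.measurableSet (norm_signed_coordinate _ _).le hδ0
    _ = ENNReal.ofReal (2 * m * (3 * m * δ)) := by
        rw [Finset.sum_const, Finset.card_univ, hcard, nsmul_eq_mul, ← ENNReal.ofReal_natCast,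
          ← ENNReal.ofReal_mul (by positivity)]
        push_cast; rfl
    _ ≤ _ := by
        refine ENNReal.ofReal_le_ofReal ?_
        have : Real.sqrt m ≤ m := Real.sqrt_le_iff.2 ⟨by positivity, by nlinarith⟩
        rw [hδ]
        calc 2 * m * (3 * m * (s * Real.sqrt m)) ≤ 2 * m * (3 * m * (s * m)) := by gcongr
          _ = _ := by ring

/-! ### Negative cones and deterministic margins. -/

/-- The cone generated by the vectors `-a l` with `l ∈ J`. -/
def negCone {n m : ℕ} (a : Fin n → Euc m) (J : Finset (Fin n)) : Set (Euc m) :=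
  {x | ∃ μ : Fin n → ℝ, (∀ l, 0 ≤ μ l) ∧ x = -∑ l ∈ J, μ l • a l}

/-- Every `a l` with `l ∈ J` has a negative scalar product with one common vector. -/
def StrictlyFeasible {n m : ℕ} (a : Fin n → Euc m) (J : Finset (Fin n)) : Prop :=
  ∃ y : Euc m, ∀ l ∈ J, inner ℝ (a l) y < 0

/-- The set of the indices of the first `k` rows. -/
def initRows (n k : ℕ) : Finset (Fin n) := Finset.univ.filter fun l => l.val < k

/-- The coordinate vector `± e_k`. -/
noncomputable def signedCoordinate {m : ℕ} (p : Fin m × ℤˣ) : Euc m :=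
  ((p.2 : ℤ) : ℝ) • EuclideanSpace.single p.1 (1 : ℝ)

section Cone

variable {n m : ℕ} {a : Fin n → Euc m} {J : Finset (Fin n)}

theorem zero_mem_negCone : (0 : Euc m) ∈ negCone a J :=
  ⟨0, fun _ => le_rfl, by simp⟩

theorem negCone_nonempty : (negCone a J).Nonempty := ⟨0, zero_mem_negCone⟩

theorem smul_mem_negCone {x : Euc m} (hx : x ∈ negCone a J) {r : ℝ} (hr : 0 ≤ r) :
    r • x ∈ negCone a J := by
  obtain ⟨μ, hμ, rfl⟩ := hx
  exact ⟨fun l => r * μ l, fun l => mul_nonneg hr (hμ l), by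
    simp [Finset.smul_sum, smul_smul]⟩

theorem convex_negCone : Convex ℝ (negCone a J) := by
  rintro _ ⟨μ, hμ, rfl⟩ _ ⟨ν, hν, rfl⟩ r s hr hs -
  refine ⟨fun l => r * μ l + s * ν l,
    fun l => add_nonneg (mul_nonneg hr (hμ l)) (mul_nonneg hs (hν l)), ?_⟩
  simp only [add_smul, Finset.sum_add_distrib, smul_neg, Finset.smul_sum, smul_smul]
  abel

theorem neg_smul_mem_negCone {l : Fin n} (hl : l ∈ J) {r : ℝ} (hr : 0 ≤ r) :
    -(r • a l) ∈ negCone a J := by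
  refine ⟨Pi.single l r, fun k => ?_, ?_⟩
  · by_cases h : k = l
    · subst h; simpa using hr
    · simp [h]
  · rw [Finset.sum_eq_single_of_mem l hl fun k _ hk => by simp [hk]]
    simp

theorem negCone_congr {b : Fin n → Euc m} (h : ∀ l ∈ J, a l = b l) :
    negCone a J = negCone b J := by
  unfold negCone
  ext x
  refine exists_congr fun μ => and_congr_right fun _ => ?_
  rw [Finset.sum_congr rfl fun l hl => by rw [h l hl]]

theorem infDist_smul_negCone (u : Euc m) {r : ℝ} (hr : 0 < r) :
    Metric.infDist (r • u) (negCone a J) = r * Metric.infDist u (negCone a J) := by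
  have key : ∀ (w : Euc m) {t : ℝ}, 0 < t →
      Metric.infDist (t • w) (negCone a J) ≤ t * Metric.infDist w (negCone a J) := by
    intro w t ht
    rw [mul_comm, ← div_le_iff₀ ht, Metric.le_infDist negCone_nonempty]
    intro y hy
    rw [div_le_iff₀ ht]
    refine (Metric.infDist_le_dist_of_mem (smul_mem_negCone hy ht.le)).trans_eq ?_
    rw [dist_smul₀, Real.norm_of_nonneg ht.le, mul_comm]
  refine le_antisymm (key u hr) ?_
  have := key (r • u) (inv_pos.2 hr)
  rw [smul_smul, inv_mul_cancel₀ hr.ne', one_smul] at this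
  rwa [← le_div_iff₀' hr, div_eq_inv_mul]

/-- A strict solution `y` separates: the inner product with `y` is nonnegative on the negative cone
and negative at `a i`. -/
theorem StrictlyFeasible.infDist_pos {J' : Finset (Fin n)} {i : Fin n} (hJ : J' ⊆ J) (hi : i ∈ J)
    (h : StrictlyFeasible a J) : 0 < Metric.infDist (a i) (negCone a J') := by
  obtain ⟨y, hy⟩ := h
  have hy0 : 0 < ‖y‖ := by
    rw [norm_pos_iff]
    rintro rfl
    simpa using hy i hi
  refine lt_of_lt_of_le (div_pos (neg_pos.2 (hy i hi)) hy0)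
    ((Metric.le_infDist negCone_nonempty).2 ?_)
  rintro _ ⟨μ, hμ, rfl⟩
  rw [dist_eq_norm, div_le_iff₀ hy0, sub_neg_eq_add]
  have h1 : inner ℝ (∑ l ∈ J', μ l • a l) y ≤ 0 := by
    rw [sum_inner]
    refine Finset.sum_nonpos fun l hl => ?_
    rw [inner_smul_left]
    exact mul_nonpos_of_nonneg_of_nonpos (hμ l) (hy l (hJ hl)).le
  have h2 := abs_real_inner_le_norm (a i + ∑ l ∈ J', μ l • a l) y
  rw [inner_add_left] at h2
  linarith [neg_le_abs (inner ℝ (a i) y + inner ℝ (∑ l ∈ J', μ l • a l) y)]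

theorem exists_norm_eq_one (hm : 1 ≤ m) : ∃ y : Euc m, ‖y‖ = 1 :=
  ⟨EuclideanSpace.single ⟨0, hm⟩ 1, by simp⟩

/-- If no row of a strictly feasible system is close to, but outside of, the negative cone of the
other rows, then the system is feasible with a margin. -/
theorem StrictlyFeasible.exists_margin (hm : 1 ≤ m) (h : StrictlyFeasible a J) {s : ℝ}
    (hO : ∀ i ∈ J, ¬ (0 < Metric.infDist (a i) (negCone a (J.erase i)) ∧
      Metric.infDist (a i) (negCone a (J.erase i)) ≤ s)) :
    ∃ y : Euc m, ‖y‖ = 1 ∧ ∀ i ∈ J, inner ℝ (a i) y ≤ -(s / n) := by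
  rcases J.eq_empty_or_nonempty with rfl | ⟨i₀, hi₀⟩
  · obtain ⟨y, hy⟩ := exists_norm_eq_one hm
    exact ⟨y, hy, by simp⟩
  have hn : (0 : ℝ) < n := by exact_mod_cast i₀.pos
  have hs : ∀ i ∈ J, s < Metric.infDist (a i) (negCone a (J.erase i)) := fun i hi => by
    have h1 := h.infDist_pos (J.erase_subset i) hi
    by_contra h2
    exact hO i hi ⟨h1, not_lt.1 h2⟩
  obtain ⟨y, hy⟩ := h
  -- The image of Λ is the convex hull of the rows in `J`. If `c` is its point nearest to 0, then
  -- -c/‖c‖ solves the system with margin ‖c‖, so ‖c‖ has to be bounded below.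
  let Λ : Set (Fin n → ℝ) := stdSimplex ℝ (Fin n) ∩ {μ | ∀ l, l ∉ J → μ l = 0}
  have hΛc : IsCompact Λ := by
    refine (isCompact_stdSimplex ℝ (Fin n)).inter_right ?_
    simp only [Set.ofPred_forall]
    exact isClosed_iInter fun l => isClosed_iInter fun _ =>
      isClosed_eq (continuous_apply l) continuous_const
  have hΛ : Convex ℝ Λ := by
    refine (convex_stdSimplex ℝ (Fin n)).inter ?_
    intro μ hμ ν hν r t _ _ _ l hl
    simp [hμ l hl, hν l hl]
  let f := Fintype.linearCombination ℝ a
  have hf : Continuous f := f.continuous_of_finiteDimensional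
  have hsingle : ∀ i ∈ J, a i ∈ f '' Λ := by
    intro i hi
    refine ⟨Pi.single i 1, ⟨single_mem_stdSimplex ℝ i, fun l hl => ?_⟩, ?_⟩
    · exact Pi.single_eq_of_ne (by rintro rfl; exact hl hi) _
    · simp [f]
  have hK : Convex ℝ (f '' Λ) := hΛ.linear_image f
  obtain ⟨c, hcK, hc⟩ := exists_norm_eq_iInf_of_complete_convex ⟨_, hsingle i₀ hi₀⟩
    (hΛc.image hf).isComplete hK (0 : Euc m)
  have hproj := (norm_eq_iInf_iff_real_inner_le_zero hK hcK).1 hc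
  have hca : ∀ i ∈ J, ‖c‖ ^ 2 ≤ inner ℝ (a i) c := by
    intro i hi
    have := hproj _ (hsingle i hi)
    rw [zero_sub, inner_neg_left, inner_sub_right, real_inner_self_eq_norm_sq,
      real_inner_comm] at this
    linarith
  obtain ⟨μ, ⟨⟨hμ0, hμ1⟩, hμJ⟩, hμc⟩ := hcK
  have hsumJ : ∀ g : Fin n → Euc m, ∑ l, μ l • g l = ∑ l ∈ J, μ l • g l := fun g =>
    (Finset.sum_subset (Finset.subset_univ J) fun l _ hl => by rw [hμJ l hl, zero_smul]).symm
  have hcsum : c = ∑ l ∈ J, μ l • a l := by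
    rw [← hμc, ← hsumJ]
    exact Fintype.linearCombination_apply ℝ a μ
  obtain ⟨i, hi⟩ : ∃ i, 1 / (n : ℝ) ≤ μ i := by
    by_contra! hlt
    have : ∑ i, μ i < ∑ _i : Fin n, 1 / (n : ℝ) :=
      Finset.sum_lt_sum_of_nonempty ⟨i₀, Finset.mem_univ _⟩ fun i _ => hlt i
    rw [hμ1] at this
    simp [hn.ne'] at this
  have hμi : 0 < μ i := lt_of_lt_of_le (by positivity) hi
  have hiJ : i ∈ J := by
    by_contra hiJ
    exact hμi.ne' (hμJ i hiJ)
  have hcs : s / n < ‖c‖ ∨ s ≤ 0 := by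
    rcases le_or_gt s 0 with h0 | h0
    · exact Or.inr h0
    left
    have hmem : -∑ l ∈ J.erase i, (μ l / μ i) • a l ∈ negCone a (J.erase i) :=
      ⟨fun l => μ l / μ i, fun l => div_nonneg (hμ0 l) hμi.le, rfl⟩
    have h1 := (hs i hiJ).trans_le (Metric.infDist_le_dist_of_mem hmem)
    -- Dividing the convex combination `c` by its largest-type weight μᵢ ≥ 1/n exhibits c/μᵢ as the
    -- difference of `a i` and a point of the cone of the others, so ‖c‖ > s μᵢ ≥ s/n.
    have h2 : a i - -∑ l ∈ J.erase i, (μ l / μ i) • a l = (μ i)⁻¹ • c := by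
      rw [hcsum, ← Finset.add_sum_erase _ _ hiJ, smul_add, smul_smul, inv_mul_cancel₀ hμi.ne',
        one_smul, Finset.smul_sum, sub_neg_eq_add]
      simp only [smul_smul, div_eq_inv_mul]
    rw [dist_eq_norm, h2, norm_smul, Real.norm_of_nonneg (by positivity), ← div_eq_inv_mul,
      lt_div_iff₀ hμi] at h1
    calc s / n = s * (1 / n) := by ring
      _ ≤ s * μ i := by gcongr
      _ < _ := h1
  have hc0 : 0 < ‖c‖ := by
    rw [norm_pos_iff]
    intro h0
    have h1 : inner ℝ c y < 0 := by
      rw [hcsum, sum_inner]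
      refine Finset.sum_neg' (fun l hl => ?_) ⟨i, hiJ, ?_⟩
      · rw [inner_smul_left]
        exact mul_nonpos_of_nonneg_of_nonpos (hμ0 l) (hy l hl).le
      · rw [inner_smul_left]
        exact mul_neg_of_pos_of_neg hμi (hy i hiJ)
    rw [h0, inner_zero_left] at h1
    exact lt_irrefl _ h1
  refine ⟨-(‖c‖⁻¹ • c), ?_, fun l hl => ?_⟩
  · rw [norm_neg, norm_smul, norm_inv, norm_norm, inv_mul_cancel₀ hc0.ne']
  · rw [inner_neg_right, inner_smul_right, neg_le_neg_iff]
    have h1 : s / n ≤ ‖c‖ := by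
      rcases hcs with h1 | h1
      · exact h1.le
      · exact (div_nonpos_of_nonpos_of_nonneg h1 hn.le).trans hc0.le
    refine h1.trans ?_
    rw [← div_eq_inv_mul, le_div_iff₀ hc0]
    nlinarith [hca l hl]

/-- If adding the unit vector `a j` destroys strict feasibility, then `a j` lies in the closure of
the negative cone of the other vectors. -/
theorem infDist_eq_zero_of_not_strictlyFeasible {j : Fin n} (haj : ‖a j‖ ≤ 1) {y : Euc m}
    (hy : ‖y‖ = 1) (hyJ : ∀ l ∈ J, inner ℝ (a l) y < 0)
    (hnot : ¬ StrictlyFeasible a (insert j J)) : Metric.infDist (a j) (negCone a J) = 0 := by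
  by_contra hne
  have hpos := lt_of_le_of_ne Metric.infDist_nonneg (Ne.symm hne)
  obtain ⟨f, u, hf1, hf2⟩ := geometric_hahn_banach_open (convex_ball _ _) Metric.isOpen_ball
    convex_negCone (Metric.disjoint_ball_infDist (x := a j) (s := negCone a J))
  set v := (InnerProductSpace.toDual ℝ (Euc m)).symm f with hv
  have hfv : ∀ w, f w = inner ℝ w v := fun w => by
    rw [real_inner_comm]; simp [hv]
  have hu0 : u ≤ 0 := by simpa using hf2 0 zero_mem_negCone
  have hju : inner ℝ (a j) v < 0 := by
    rw [← hfv]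
    exact (hf1 _ (Metric.mem_ball_self hpos)).trans_le hu0
  have hl : ∀ l ∈ J, inner ℝ (a l) v ≤ 0 := by
    intro l hlJ
    by_contra! hlt
    -- The multiple is chosen so that the functional takes the value u - 1 on the cone, below its
    -- lower bound u.
    have h1 := hf2 _ (neg_smul_mem_negCone (a := a) hlJ
      (r := (1 - u) / inner ℝ (a l) v) (div_nonneg (by linarith) hlt.le))
    rw [hfv, inner_neg_left, inner_smul_left, conj_trivial, div_mul_cancel₀ _ hlt.ne'] at h1
    linarith
  -- The separating vector is strict only at `a j`. Adding a small multiple of the strict solution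
  -- `y` makes all rows of `J` strict and uses up at most half of the slack at `a j`.
  refine hnot ⟨v + (-(inner ℝ (a j) v) / 2) • y, fun l hlJ => ?_⟩
  rw [inner_add_right, inner_smul_right]
  rcases Finset.mem_insert.1 hlJ with rfl | hlJ
  · have h1 : inner ℝ (a l) y ≤ 1 := (real_inner_le_norm _ _).trans (by rw [hy, mul_one]; exact haj)
    nlinarith
  · have := mul_neg_of_pos_of_neg (by linarith : 0 < -(inner ℝ (a j) v) / 2) (hyJ l hlJ)
    linarith [hl l hlJ]

/-- If a margin-feasible system becomes infeasible by adding `a j`, and `a j` is not close to the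
boundary of the negative cone of the others, then the system is infeasible with a margin. -/
theorem exists_le_inner_of_not_strictlyFeasible {j : Fin n} (haj : ‖a j‖ ≤ 1) {y : Euc m}
    (hm : 1 ≤ m) (hy : ‖y‖ = 1) {t δ : ℝ} (ht : 0 < t) (ht1 : t ≤ 1) (hδ : 0 < δ) (hδ1 : δ ≤ 1)
    (hyJ : ∀ l ∈ J, inner ℝ (a l) y ≤ -t) (hnot : ¬ StrictlyFeasible a (insert j J))
    (hI : ∀ p, ¬ (Metric.infDist (a j) (negCone a J) = 0 ∧
      0 < Metric.infDist (a j + δ • signedCoordinate p) (negCone a J)))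
    {x : Euc m} (hx : ‖x‖ = 1) : ∃ i, δ * t / (5 * Real.sqrt m) ≤ inner ℝ (a i) x := by
  have h0 := infDist_eq_zero_of_not_strictlyFeasible haj hy
    (fun l hl => (hyJ l hl).trans_lt (neg_neg_of_pos ht)) hnot
  have hm0 : (0 : ℝ) < m := by exact_mod_cast hm
  have hsm : 0 < Real.sqrt m := Real.sqrt_pos.2 hm0
  set ε := δ * t / (5 * Real.sqrt m) with hε
  have hε0 : 0 < ε := by positivity
  by_contra! hlt
  obtain ⟨k, b, hkb⟩ := exists_signed_coordinate hm (-x)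
  set D : Euc m := signedCoordinate (k, b) with hD
  have hDn : ‖D‖ = 1 := norm_signed_coordinate k b
  have hxD : inner ℝ D x ≤ -(1 / Real.sqrt m) := by
    change _ ≤ inner ℝ (-x) D at hkb
    rw [norm_neg, hx, inner_neg_left, real_inner_comm] at hkb
    linarith
  have hz : Metric.infDist (a j + δ • D) (negCone a J) = 0 :=
    le_antisymm (not_lt.1 fun h => hI (k, b) ⟨h0, h⟩) Metric.infDist_nonneg
  -- The shifted row lies only in the closure of the cone, so it is approximated with error η; a
  -- tenth of δ/√m is affordable in the final comparison.
  set η := min 1 (δ / (10 * Real.sqrt m)) with hη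
  have hη0 : 0 < η := lt_min one_pos (by positivity)
  obtain ⟨_, ⟨μ, hμ, rfl⟩, hd⟩ := (Metric.infDist_lt_iff negCone_nonempty).1 (hz.trans_lt hη0)
  rw [dist_eq_norm, sub_neg_eq_add] at hd
  set w := a j + δ • D + ∑ l ∈ J, μ l • a l with hw
  set M := ∑ l ∈ J, μ l with hM
  have hM0 : 0 ≤ M := Finset.sum_nonneg fun l _ => hμ l
  have hwx : -η ≤ inner ℝ w x := by
    have := abs_real_inner_le_norm w x
    rw [hx, mul_one] at this
    linarith [neg_abs_le (inner ℝ w x)]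
  have hwy : -η ≤ inner ℝ w y := by
    have := abs_real_inner_le_norm w y
    rw [hy, mul_one] at this
    linarith [neg_abs_le (inner ℝ w y)]
  have hsx : inner ℝ (∑ l ∈ J, μ l • a l) x ≤ M * ε := by
    rw [sum_inner, hM, Finset.sum_mul]
    refine Finset.sum_le_sum fun l _ => ?_
    rw [inner_smul_left]
    exact mul_le_mul_of_nonneg_left (hlt l).le (hμ l)
  have hsy : inner ℝ (∑ l ∈ J, μ l • a l) y ≤ -(M * t) := by
    rw [sum_inner, hM, Finset.sum_mul, ← Finset.sum_neg_distrib]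
    refine Finset.sum_le_sum fun l hl => ?_
    rw [inner_smul_left, ← mul_neg]
    exact mul_le_mul_of_nonneg_left (hyJ l hl) (hμ l)
  have hjy : inner ℝ (a j) y ≤ 1 :=
    (real_inner_le_norm _ _).trans (by rw [hy, mul_one]; exact haj)
  have hDy : inner ℝ D y ≤ 1 :=
    (real_inner_le_norm _ _).trans (by rw [hy, hDn, mul_one])
  rw [hw, inner_add_left, inner_add_left, inner_smul_left, conj_trivial] at hwx hwy
  -- Pairing with `y` bounds the total weight: M t ≤ 1 + δ + η ≤ 3.
  have hMt : M * t ≤ 3 := by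
    have := mul_le_mul_of_nonneg_left hDy hδ.le
    linarith [min_le_left 1 (δ / (10 * Real.sqrt m))]
  -- Pairing with `x`: the shift contributes at most -δ/√m, which the rows, each below ε, cannot
  -- compensate. The right side is at most (1/10 + 4/5) δ/√m.
  have h1 : δ / Real.sqrt m ≤ η + ε + M * ε := by
    have := mul_le_mul_of_nonneg_left hxD hδ.le
    have h2 : δ * -(1 / Real.sqrt m) = -(δ / Real.sqrt m) := by ring
    linarith [hlt j]
  have h2 : ε + M * ε ≤ 4 / 5 * (δ / Real.sqrt m) := by
    have h3 : ε = t * (1 / 5 * (δ / Real.sqrt m)) := by rw [hε]; field_simp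
    have h4 : 0 < δ / Real.sqrt m := by positivity
    rw [h3]
    nlinarith
  have h3 : η ≤ 1 / 10 * (δ / Real.sqrt m) := (min_le_right _ _).trans_eq (by ring)
  have h4 : 0 < δ / Real.sqrt m := by positivity
  linarith

theorem initRows_self (n : ℕ) : initRows n n = Finset.univ := by
  simp [initRows]

theorem notMem_initRows (j : Fin n) : j ∉ initRows n j := by
  simp [initRows]

theorem initRows_succ (j : Fin n) : initRows n (j + 1) = insert j (initRows n j) := by
  ext l
  simp only [initRows, Finset.mem_filter, Finset.mem_univ, true_and, Finset.mem_insert, Fin.ext_iff]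
  omega

/-- A system of unit vectors none of which is close to the boundary of the cones of the others is
either feasible with a margin or infeasible with a margin. -/
theorem exists_margin_or (hm : 1 ≤ m) (hmn : m ≤ n) (ha : ∀ i, ‖a i‖ = 1) {δ : ℝ} (hδ : 0 < δ)
    (hδ1 : δ ≤ 1)
    (hO : ∀ k ≤ n, ∀ i ∈ initRows n k,
      ¬ (0 < Metric.infDist (a i) (negCone a ((initRows n k).erase i)) ∧
      Metric.infDist (a i) (negCone a ((initRows n k).erase i)) ≤ δ))
    (hI : ∀ (j : Fin n) (p : Fin m × ℤˣ),
      ¬ (Metric.infDist (a j) (negCone a (initRows n j)) = 0 ∧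
      0 < Metric.infDist (a j + δ • signedCoordinate p) (negCone a (initRows n j)))) :
    (∃ y : Euc m, ‖y‖ = 1 ∧ ∀ i, inner ℝ (a i) y ≤ -(δ ^ 2 / (5 * n ^ 2))) ∨
      ∀ x : Euc m, ‖x‖ = 1 → ∃ i, δ ^ 2 / (5 * n ^ 2) ≤ inner ℝ (a i) x := by
  have hm0 : (0 : ℝ) < m := by exact_mod_cast hm
  have hn1 : (1 : ℝ) ≤ n := by exact_mod_cast hm.trans hmn
  have hmn' : (m : ℝ) ≤ n := by exact_mod_cast hmn
  by_cases hf : StrictlyFeasible a Finset.univ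
  · left
    rw [← initRows_self] at hf
    obtain ⟨y, hy, h⟩ := hf.exists_margin hm (hO n le_rfl)
    refine ⟨y, hy, fun i => (h i (by rw [initRows_self]; exact Finset.mem_univ i)).trans ?_⟩
    rw [neg_le_neg_iff, div_le_div_iff₀ (by positivity) (by positivity)]
    calc δ ^ 2 * n = δ * (δ * n * 1) := by ring
      _ ≤ δ * (1 * (n * (5 * n))) := by
          have : 1 ≤ 5 * (n : ℝ) := by linarith
          rw [mul_assoc]
          gcongr
      _ = _ := by ring
  · right
    -- Rows are added one at a time from the empty, feasible system; `j` is a row at which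
    -- feasibility is lost.
    obtain ⟨j, hj1, hj2⟩ : ∃ j : Fin n, StrictlyFeasible a (initRows n j) ∧
        ¬ StrictlyFeasible a (insert j (initRows n j)) := by
      by_contra! hcon
      apply hf
      rw [← initRows_self]
      have : ∀ k ≤ n, StrictlyFeasible a (initRows n k) := by
        intro k
        induction k with
        | zero => exact fun _ => ⟨0, by simp [initRows]⟩
        | succ k ih =>
          intro hk
          have h1 := hcon ⟨k, hk⟩ (ih (by omega))
          rwa [← initRows_succ] at h1
      exact this n le_rfl
    intro x hx
    obtain ⟨y, hy, h⟩ := hj1.exists_margin hm (hO j j.2.le)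
    obtain ⟨i, hi⟩ := exists_le_inner_of_not_strictlyFeasible (ha j).le hm hy
      (div_pos hδ (by linarith : (0 : ℝ) < n)) (div_le_one_of_le₀ (by linarith) (by linarith)) hδ hδ1 h
      hj2 (hI j) hx
    refine ⟨i, le_trans ?_ hi⟩
    have hs : Real.sqrt m ≤ n := Real.sqrt_le_iff.2 ⟨by linarith, by nlinarith⟩
    have hsm : 0 < Real.sqrt m := Real.sqrt_pos.2 hm0
    rw [div_le_div_iff₀ (by positivity) (by positivity)]
    calc δ ^ 2 * (5 * Real.sqrt m) ≤ δ ^ 2 * (5 * n) := by gcongr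
      _ = _ := by field_simp

end Cone

/-! ### From margins to the condition number. -/

section Theta

variable {n m : ℕ} {A : Matrix (Fin n) (Fin m) ℝ}

theorem bddAbove_thetaAt (hn : 1 ≤ n) (A : Matrix (Fin n) (Fin m) ℝ) : BddAbove (Set.range
    fun x : {x : EuclideanSpace ℝ (Fin m) // x ≠ 0} => thetaAt A x) :=
  ⟨Real.pi, by rintro _ ⟨x, rfl⟩; exact thetaAt_le_pi hn A _⟩

theorem nonempty_ne_zero (hm : 1 ≤ m) : Nonempty {x : EuclideanSpace ℝ (Fin m) // x ≠ 0} := by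
  obtain ⟨y, hy⟩ := exists_norm_eq_one hm
  exact ⟨⟨y, by rintro rfl; simp at hy⟩⟩

theorem cos_theta_le_of_forall_inner_le (hm : 1 ≤ m) (hn : 1 ≤ n) (hA : ∀ i, ‖rowVec A i‖ = 1)
    {c : ℝ} (hc : 0 ≤ c) {y : Euc m} (hy : ‖y‖ = 1) (h : ∀ i, inner ℝ (rowVec A i) y ≤ -c) :
    Real.cos (theta A) ≤ -c := by
  have : Nonempty (Fin n) := ⟨⟨0, hn⟩⟩
  have := nonempty_ne_zero hm
  have hy0 : y ≠ 0 := by rintro rfl; simp at hy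
  have hc1 : -1 ≤ -c := by
    have h2 := abs_real_inner_le_norm (rowVec A ⟨0, hn⟩) y
    rw [hA, hy, mul_one] at h2
    linarith [neg_abs_le (inner ℝ (rowVec A ⟨0, hn⟩) y), h ⟨0, hn⟩]
  rw [← Real.cos_arccos hc1 (by linarith)]
  refine Real.cos_le_cos_of_nonneg_of_le_pi (Real.arccos_nonneg _)
    (ciSup_le fun x => thetaAt_le_pi hn A _) ?_
  refine le_trans ?_ (le_ciSup (bddAbove_thetaAt hn A) ⟨y, hy0⟩)
  refine le_ciInf fun i => Real.arccos_le_arccos ?_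
  rw [hA, hy, mul_one, div_one]
  exact h i

theorem le_cos_theta_of_forall_exists_inner_ge (hm : 1 ≤ m) (hA : ∀ i, ‖rowVec A i‖ = 1) {c : ℝ}
    (hc : 0 ≤ c) (h : ∀ x : Euc m, ‖x‖ = 1 → ∃ i, c ≤ inner ℝ (rowVec A i) x) :
    c ≤ Real.cos (theta A) := by
  have := nonempty_ne_zero hm
  have hc1 : c ≤ 1 := by
    obtain ⟨y, hy⟩ := exists_norm_eq_one hm
    obtain ⟨i, hi⟩ := h y hy
    have h2 := real_inner_le_norm (rowVec A i) y
    rw [hA, hy, mul_one] at h2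
    linarith
  rw [← Real.cos_arccos (by linarith : -1 ≤ c) hc1]
  refine Real.cos_le_cos_of_nonneg_of_le_pi (Real.iSup_nonneg fun x => Real.iInf_nonneg fun i =>
    InnerProductGeometry.angle_nonneg _ _) (Real.arccos_le_pi _) (ciSup_le fun ⟨x, hx⟩ => ?_)
  have hx0 : 0 < ‖x‖ := norm_pos_iff.2 hx
  have hx1 : ‖‖x‖⁻¹ • x‖ = 1 := by rw [norm_smul, norm_inv, norm_norm, inv_mul_cancel₀ hx0.ne']
  obtain ⟨i, hi⟩ := h (‖x‖⁻¹ • x) hx1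
  refine (ciInf_le (Set.finite_range _).bddBelow i).trans ?_
  rw [← InnerProductGeometry.angle_smul_right_of_pos _ x (inv_pos.2 hx0)]
  refine Real.arccos_le_arccos ?_
  rwa [hA, hx1, mul_one, div_one]

theorem logConditionNumber_le_of_le_abs_cos {τ : ℝ}
    (h : Real.exp (-τ) ≤ |Real.cos (theta A)|) : logConditionNumber A ≤ ENNReal.ofReal τ := by
  have h1 : conditionNumber A ≤ ENNReal.ofReal (Real.exp τ) := by
    rw [conditionNumber, ENNReal.inv_le_iff_inv_le,
      ← ENNReal.ofReal_inv_of_pos (Real.exp_pos _), ← Real.exp_neg]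
    exact ENNReal.ofReal_le_ofReal h
  have h2 : ENNReal.log (ENNReal.ofReal (Real.exp τ)) = (τ : EReal) := by
    rw [ENNReal.log_ofReal_of_pos (Real.exp_pos _), Real.log_exp]
  refine (EReal.toENNReal_le_toENNReal ((ENNReal.log_monotone h1).trans_eq h2)).trans_eq ?_
  rw [EReal.toENNReal_of_ne_top (EReal.coe_ne_top τ), EReal.toReal_coe]

theorem logConditionNumber_le_of_margin (hm : 1 ≤ m) (hn : 1 ≤ n) (hA : ∀ i, ‖rowVec A i‖ = 1)
    {τ : ℝ} (h : (∃ y : Euc m, ‖y‖ = 1 ∧ ∀ i, inner ℝ (rowVec A i) y ≤ -Real.exp (-τ)) ∨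
      ∀ x : Euc m, ‖x‖ = 1 → ∃ i, Real.exp (-τ) ≤ inner ℝ (rowVec A i) x) :
    logConditionNumber A ≤ ENNReal.ofReal τ := by
  refine logConditionNumber_le_of_le_abs_cos ?_
  rcases h with ⟨y, hy, h⟩ | h
  · have := cos_theta_le_of_forall_inner_le hm hn hA (Real.exp_pos _).le hy h
    exact le_abs.2 (Or.inr (by linarith))
  · exact (le_cos_theta_of_forall_exists_inner_ge hm hA (Real.exp_pos _).le h).trans (le_abs_self _)

end Theta

/-! ### The law of the rows and the tail bound. -/

/-- The law of the rows of a uniform random `n × m` matrix. -/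
noncomputable def rowsLaw (m n : ℕ) : Measure (Fin n → Euc m) :=
  Measure.pi fun _ => sphereLaw m

/-- The matrix with given rows. -/
def rowsMatrix {n m : ℕ} (a : Fin n → Euc m) : Matrix (Fin n) (Fin m) ℝ := fun i => (a i).ofLp

theorem isProbabilityMeasure_rowsLaw {m : ℕ} (hm : 1 ≤ m) (n : ℕ) :
    IsProbabilityMeasure (rowsLaw m n) :=
  have := isProbabilityMeasure_sphereLaw hm
  inferInstanceAs (IsProbabilityMeasure (Measure.pi fun _ : Fin n => sphereLaw m))

theorem ae_norm_eq_one {m : ℕ} (hm : 1 ≤ m) (n : ℕ) : ∀ᵐ a ∂(rowsLaw m n), ∀ i, ‖a i‖ = 1 := by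
  have := isProbabilityMeasure_sphereLaw hm
  rw [ae_all_iff]
  intro i
  exact (Measure.quasiMeasurePreserving_eval (μ := fun _ : Fin n => sphereLaw m) i).ae
    sphereLaw_ae_norm

/-- An event whose probability conditionally on all the other coordinates is at most `p` has
probability at most `p`. -/
theorem pi_measure_le_of_forall_update {ι X : Type*} [Fintype ι] [DecidableEq ι]
    [MeasurableSpace X] {μ : Measure X} [IsProbabilityMeasure μ] (i : ι) {S : Set (ι → X)}
    (hS : MeasurableSet S) {p : ℝ≥0∞} (h : ∀ a, μ {v | Function.update a i v ∈ S} ≤ p) :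
    Measure.pi (fun _ : ι => μ) S ≤ p := by
  have : Nonempty X := nonempty_of_isProbabilityMeasure μ
  let a₀ : ι → X := fun _ => Classical.arbitrary X
  have hf : Measurable (S.indicator (1 : (ι → X) → ℝ≥0∞)) := measurable_one.indicator hS
  rw [← lintegral_indicator_one hS, lintegral_eq_lmarginal_univ a₀,
    lmarginal_erase' _ hf (Finset.mem_univ i)]
  have hle : (fun a => ∫⁻ v, S.indicator (1 : (ι → X) → ℝ≥0∞) (Function.update a i v) ∂μ) ≤
      fun _ => p := by
    intro a
    refine le_trans (le_of_eq ?_) (h a)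
    exact lintegral_indicator_one (s := {v | Function.update a i v ∈ S}) (measurable_update a hS)
  refine (lmarginal_mono hle a₀).trans ?_
  simp [lmarginal]

section Cone

variable {n m : ℕ}

theorem sphereLaw_outer_le (hm : 1 ≤ m) (a : Fin n → Euc m) (J : Finset (Fin n)) {s : ℝ}
    (hs : 0 < s) :
    sphereLaw m {u | 0 < Metric.infDist u (negCone a J) ∧ Metric.infDist u (negCone a J) ≤ s} ≤
      ENNReal.ofReal (6 * m ^ 3 * s) := by
  have hmeas : Measurable fun u => Metric.infDist u (negCone a J) := by fun_prop
  refine (sphereLaw_le_ballMeasure hm ?_ ?_).trans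
    (ballMeasure_thickening_sdiff_le hm (convex_negCone (a := a) (J := J)) negCone_nonempty hs)
  · exact (measurableSet_lt measurable_const hmeas).inter (measurableSet_le hmeas measurable_const)
  · rintro u ⟨h1, h2⟩ - r ⟨hr0, hr1⟩
    rw [Set.mem_ofPred_eq, infDist_smul_negCone u hr0]
    exact ⟨mul_pos hr0 h1, by nlinarith⟩

/-- The closed cone `K` is invariant under positive scaling. If `r • u` stayed in `K` after the full
step δ, it would by convexity after the step rδ, that is, r times the shifted `u` would lie in `K`.
-/
theorem sphereLaw_inner_le (hm : 1 ≤ m) (a : Fin n → Euc m) (J : Finset (Fin n)) {δ : ℝ}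
    (hδ : 0 < δ) (p : Fin m × ℤˣ) :
    sphereLaw m {u | Metric.infDist u (negCone a J) = 0 ∧
      0 < Metric.infDist (u + δ • signedCoordinate p) (negCone a J)} ≤
      ENNReal.ofReal (3 * m * δ) := by
  have hmeas : Measurable fun u => Metric.infDist u (negCone a J) := by fun_prop
  have hmem : ∀ u, u ∈ closure (negCone a J) ↔ Metric.infDist u (negCone a J) = 0 := fun u =>
    Metric.mem_closure_iff_infDist_zero negCone_nonempty
  refine (sphereLaw_le_ballMeasure hm ?_ ?_).trans
    (ballMeasure_convex_exit_le hm (convex_negCone (a := a) (J := J)).closure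
      isClosed_closure.measurableSet (norm_signed_coordinate p.1 p.2).le hδ)
  · exact (measurableSet_eq_fun hmeas measurable_const).inter
      (measurableSet_lt measurable_const (hmeas.comp (measurable_add_const _)))
  · rintro u ⟨h1, h2⟩ - r ⟨hr0, hr1⟩
    have hru : r • u ∈ closure (negCone a J) := by
      rw [hmem, infDist_smul_negCone u hr0, h1, mul_zero]
    refine ⟨hru, fun hcon => ?_⟩
    have h3 := convex_negCone.closure.add_smul_mem hru hcon (t := r) ⟨hr0.le, hr1.le⟩
    have h4 : r • u + r • (δ • ((p.2 : ℤ) : ℝ) • EuclideanSpace.single p.1 (1 : ℝ)) =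
      r • (u + δ • signedCoordinate p) := by rw [smul_add]; rfl
    rw [h4, hmem, infDist_smul_negCone _ hr0] at h3
    exact (mul_pos hr0 h2).ne' h3

/-- The cone moves with `a`, but for each fixed choice of coefficients the distance is continuous in
`a`; the infimum is upper semicontinuous. -/
theorem measurable_infDist_negCone (i : Fin n) (w : Euc m) (J : Finset (Fin n)) :
    Measurable fun a : Fin n → Euc m => Metric.infDist (a i + w) (negCone a J) := by
  refine measurable_of_Iio fun t => IsOpen.measurableSet ?_
  have : (fun a : Fin n → Euc m => Metric.infDist (a i + w) (negCone a J)) ⁻¹' Set.Iio t =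
      ⋃ (μ : Fin n → ℝ) (_ : ∀ l, 0 ≤ μ l), {a | dist (a i + w) (-∑ l ∈ J, μ l • a l) < t} := by
    ext a
    simp only [Set.mem_preimage, Set.mem_Iio, Metric.infDist_lt_iff negCone_nonempty,
      Set.mem_iUnion, Set.mem_ofPred_eq, exists_prop]
    constructor
    · rintro ⟨_, ⟨μ, hμ, rfl⟩, h⟩
      exact ⟨μ, hμ, h⟩
    · rintro ⟨μ, hμ, h⟩
      exact ⟨_, ⟨μ, hμ, rfl⟩, h⟩
  rw [this]
  refine isOpen_iUnion fun μ => isOpen_iUnion fun _ => isOpen_lt ?_ continuous_const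
  fun_prop

theorem measurable_infDist_negCone' (i : Fin n) (J : Finset (Fin n)) :
    Measurable fun a : Fin n → Euc m => Metric.infDist (a i) (negCone a J) := by
  simpa using measurable_infDist_negCone i (0 : Euc m) J

theorem negCone_update (a : Fin n → Euc m) {J : Finset (Fin n)} {i : Fin n} (hi : i ∉ J)
    (v : Euc m) : negCone (Function.update a i v) J = negCone a J :=
  negCone_congr fun l hl => Function.update_of_ne (by rintro rfl; exact hi hl) _ _

theorem rowsLaw_outer_le (hm : 1 ≤ m) {J : Finset (Fin n)} {i : Fin n} (hi : i ∉ J) {s : ℝ}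
    (hs : 0 < s) :
    rowsLaw m n {a | 0 < Metric.infDist (a i) (negCone a J) ∧
      Metric.infDist (a i) (negCone a J) ≤ s} ≤ ENNReal.ofReal (6 * m ^ 3 * s) := by
  have := isProbabilityMeasure_sphereLaw hm
  have hmeas := measurable_infDist_negCone' (m := m) i J
  refine pi_measure_le_of_forall_update i ((measurableSet_lt measurable_const hmeas).inter
    (measurableSet_le hmeas measurable_const)) fun a => ?_
  simpa only [Set.mem_inter_iff, Set.mem_ofPred_eq, Function.update_self, negCone_update a hi]
    using sphereLaw_outer_le hm a J hs

theorem rowsLaw_inner_le (hm : 1 ≤ m) {J : Finset (Fin n)} {i : Fin n} (hi : i ∉ J) {δ : ℝ}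
    (hδ : 0 < δ) (p : Fin m × ℤˣ) :
    rowsLaw m n {a | Metric.infDist (a i) (negCone a J) = 0 ∧
      0 < Metric.infDist (a i + δ • signedCoordinate p) (negCone a J)} ≤
      ENNReal.ofReal (3 * m * δ) := by
  have := isProbabilityMeasure_sphereLaw hm
  refine pi_measure_le_of_forall_update i
    ((measurableSet_eq_fun (measurable_infDist_negCone' i J) measurable_const).inter
    (measurableSet_lt measurable_const (measurable_infDist_negCone i _ J))) fun a => ?_
  simpa only [Set.mem_inter_iff, Set.mem_ofPred_eq, Function.update_self, negCone_update a hi]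
    using sphereLaw_inner_le hm a J hδ p

/-- Tail bound for the logarithm of the condition number. -/
theorem rowsLaw_lt_logConditionNumber_le (hm : 1 ≤ m) (hmn : m ≤ n) (τ : ℝ) :
    rowsLaw m n {a | ENNReal.ofReal τ < logConditionNumber (rowsMatrix a)} ≤
      ENNReal.ofReal (54 * n ^ 6 * Real.exp (-τ / 2)) := by
  have := isProbabilityMeasure_rowsLaw hm n
  have hn : 1 ≤ n := hm.trans hmn
  have hn1 : (1 : ℝ) ≤ n := by exact_mod_cast hn
  have hmn' : (m : ℝ) ≤ n := by exact_mod_cast hmn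
  have hm0 : (0 : ℝ) < m := by exact_mod_cast hm
  have h5 : Real.sqrt 5 ≤ 3 := Real.sqrt_le_iff.2 ⟨by norm_num, by norm_num⟩
  -- Chosen so that the margin δ²/(5n²) equals exp(-τ).
  set δ := Real.sqrt 5 * n * Real.exp (-τ / 2) with hδ
  have hδ0 : 0 < δ := by positivity
  have hδ2 : δ ^ 2 / (5 * n ^ 2) = Real.exp (-τ) := by
    rw [hδ, mul_pow, mul_pow, Real.sq_sqrt (by norm_num), ← Real.exp_nat_mul]
    rw [mul_div_cancel_left₀ _ (by positivity)]
    congr 1; push_cast; ring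
  have hfin : 18 * n ^ 5 * δ ≤ 54 * n ^ 6 * Real.exp (-τ / 2) := by
    calc 18 * (n : ℝ) ^ 5 * δ = 18 * n ^ 6 * Real.exp (-τ / 2) * Real.sqrt 5 := by rw [hδ]; ring
      _ ≤ 18 * n ^ 6 * Real.exp (-τ / 2) * 3 := by gcongr
      _ = _ := by ring
  refine le_trans ?_ (ENNReal.ofReal_le_ofReal hfin)
  -- The margin lemma needs δ ≤ 1; otherwise the claimed bound exceeds 1.
  rcases lt_or_ge 1 δ with hδ1 | hδ1
  · refine prob_le_one.trans ?_
    rw [← ENNReal.ofReal_one]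
    refine ENNReal.ofReal_le_ofReal ?_
    nlinarith [one_le_pow₀ hn1 (n := 5)]
  let O : Fin (n + 1) × Fin n → Set (Fin n → Euc m) := fun q =>
    {a | 0 < Metric.infDist (a q.2) (negCone a ((initRows n q.1).erase q.2)) ∧
      Metric.infDist (a q.2) (negCone a ((initRows n q.1).erase q.2)) ≤ δ}
  let I : Fin n × (Fin m × ℤˣ) → Set (Fin n → Euc m) := fun q =>
    {a | Metric.infDist (a q.1) (negCone a (initRows n q.1)) = 0 ∧
      0 < Metric.infDist (a q.1 + δ • signedCoordinate q.2) (negCone a (initRows n q.1))}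
  have hsub : ({a | ENNReal.ofReal τ < logConditionNumber (rowsMatrix a)} : Set (Fin n → Euc m))
      ≤ᵐ[rowsLaw m n] ((⋃ q, O q) ∪ ⋃ q, I q : Set (Fin n → Euc m)) := by
    filter_upwards [ae_norm_eq_one hm n] with a ha hlt
    by_contra hcon
    change a ∉ ((⋃ q, O q) ∪ ⋃ q, I q) at hcon
    simp only [Set.mem_union, Set.mem_iUnion, not_or, not_exists] at hcon
    refine absurd hlt (not_lt.2 (logConditionNumber_le_of_margin hm hn ha ?_))
    rw [← hδ2]
    exact exists_margin_or hm hmn ha hδ0 hδ1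
      (fun k hk i _ => hcon.1 (⟨k, Nat.lt_succ_of_le hk⟩, i)) fun j p => hcon.2 (j, p)
  have hcard : Fintype.card (Fin n × (Fin m × ℤˣ)) = n * (m * 2) := by
    rw [Fintype.card_prod, Fintype.card_prod, Fintype.card_fin, Fintype.card_fin,
      Fintype.card_units_int]
  calc _ ≤ _ := measure_mono_ae hsub
    _ ≤ rowsLaw m n (⋃ q, O q) + rowsLaw m n (⋃ q, I q) := measure_union_le _ _
    _ ≤ (∑ q, rowsLaw m n (O q)) + ∑ q, rowsLaw m n (I q) :=
        add_le_add (measure_iUnion_fintype_le _ _) (measure_iUnion_fintype_le _ _)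
    _ ≤ (∑ _q : Fin (n + 1) × Fin n, ENNReal.ofReal (6 * m ^ 3 * δ)) +
        ∑ _q : Fin n × (Fin m × ℤˣ), ENNReal.ofReal (3 * m * δ) := by
        gcongr with q _ q _
        · exact rowsLaw_outer_le hm (Finset.notMem_erase _ _) hδ0
        · exact rowsLaw_inner_le hm (notMem_initRows _) hδ0 q.2
    _ = ENNReal.ofReal ((n + 1) * n * (6 * m ^ 3 * δ) + n * (m * 2) * (3 * m * δ)) := by
        rw [Finset.sum_const, Finset.sum_const, Finset.card_univ, Finset.card_univ, hcard,
          Fintype.card_prod, Fintype.card_fin, Fintype.card_fin, nsmul_eq_mul, nsmul_eq_mul,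
          ← ENNReal.ofReal_natCast, ← ENNReal.ofReal_natCast, ← ENNReal.ofReal_mul (by positivity),
          ← ENNReal.ofReal_mul (by positivity), ← ENNReal.ofReal_add (by positivity)
          (by positivity)]
        push_cast; rfl
    _ ≤ _ := by
        refine ENNReal.ofReal_le_ofReal ?_
        calc ((n : ℝ) + 1) * n * (6 * m ^ 3 * δ) + n * (m * 2) * (3 * m * δ)
            ≤ (n + n) * n * (6 * n ^ 3 * δ) + n * (n * 2) * (3 * n * δ) := by gcongr
          _ = 12 * n ^ 5 * δ + 6 * n ^ 3 * δ * 1 := by ring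
          _ ≤ 12 * n ^ 5 * δ + 6 * n ^ 3 * δ * n ^ 2 := by gcongr; exact one_le_pow₀ hn1
          _ = _ := by ring

end Cone

/-! ### A net argument for many rows. -/

section Covering

variable {m n : ℕ}

theorem ballMeasure_neg (T : Set (Euc m)) : ballMeasure m {x | -x ∈ T} = ballMeasure m T := by
  rw [ballMeasure_apply, ballMeasure_apply,
    ← Measure.measure_preimage_neg volume (Metric.ball (0 : Euc m) 1 ∩ T)]
  congr 2
  ext x
  simp

/-- A step 1/(6m) along the normal, three times the half-width, takes every point of the slab out of
the half-space bounding it above, and the exit bound is then 3m/(6m) = 1/2. -/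
theorem ballMeasure_slab_le (hm : 1 ≤ m) {e : Euc m} (he : ‖e‖ = 1) :
    ballMeasure m {x | |inner ℝ x e| ≤ 1 / (18 * m)} ≤ ENNReal.ofReal (1 / 2) := by
  have hm0 : (0 : ℝ) < m := by exact_mod_cast hm
  have hK : Convex ℝ {x : Euc m | inner ℝ x e ≤ 1 / (18 * m)} :=
    convex_halfSpace_le ⟨fun x y => inner_add_left x y e, fun c x => by simp [inner_smul_left]⟩ _
  have hKm : MeasurableSet {x : Euc m | inner ℝ x e ≤ 1 / (18 * m)} :=
    measurableSet_le (by fun_prop) measurable_const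
  refine (measure_mono ?_).trans ((ballMeasure_convex_exit_le hm hK hKm he.le
    (δ := 1 / (6 * m)) (by positivity)).trans_eq ?_)
  · intro x hx
    have hx' := abs_le.1 (Set.mem_ofPred_eq ▸ hx)
    refine ⟨hx'.2, fun hcon => ?_⟩
    rw [Set.mem_ofPred_eq, inner_add_left, inner_smul_left, real_inner_self_eq_norm_sq, he,
      conj_trivial] at hcon
    have h1 : 1 / (6 * (m : ℝ)) = 3 * (1 / (18 * m)) := by field_simp; norm_num
    have h2 : 0 < 1 / (18 * (m : ℝ)) := by positivity
    rw [h1] at hcon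
    linarith
  · congr 1
    field_simp
    norm_num

/-- By symmetry the half-space `H` has measure at most that of its complement plus the slab, so μ(H)
≤ 1 - μ(H) + 1/2. -/
theorem ballMeasure_halfSpace_le (hm : 1 ≤ m) {e : Euc m} (he : ‖e‖ = 1) :
    ballMeasure m {x | inner ℝ x e ≤ 1 / (18 * m)} ≤ ENNReal.ofReal (3 / 4) := by
  set H := {x : Euc m | inner ℝ x e ≤ 1 / (18 * m)} with hH
  have hHm : MeasurableSet H := measurableSet_le (by fun_prop) measurable_const
  set W := {x : Euc m | |inner ℝ x e| ≤ 1 / (18 * m)} with hW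
  have h1 : H ⊆ {x | -x ∈ Hᶜ} ∪ W := by
    intro x hx
    by_cases h : -x ∈ H
    · right
      rw [hH, Set.mem_ofPred_eq] at hx h
      rw [inner_neg_left] at h
      exact abs_le.2 ⟨by linarith, hx⟩
    · exact Or.inl h
  have h2 : (ballMeasure m).real H ≤ (ballMeasure m).real Hᶜ + (ballMeasure m).real W := by
    refine (measureReal_mono h1).trans ((measureReal_union_le _ _).trans_eq ?_)
    rw [measureReal_def, ballMeasure_neg]
    rfl
  have h3 : (ballMeasure m).real W ≤ 1 / 2 :=
    ENNReal.toReal_le_of_le_ofReal (by norm_num) (ballMeasure_slab_le hm he)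
  rw [probReal_compl_eq_one_sub hHm] at h2
  rw [ENNReal.le_ofReal_iff_toReal_le (measure_ne_top _ _) (by norm_num)]
  change (ballMeasure m).real H ≤ _
  linarith

theorem sphereLaw_inner_le_le (hm : 1 ≤ m) {z : Euc m} (hz : 1 / 2 ≤ ‖z‖) :
    sphereLaw m {u | inner ℝ u z ≤ 1 / (36 * m)} ≤ ENNReal.ofReal (3 / 4) := by
  have hm0 : (0 : ℝ) < m := by exact_mod_cast hm
  have hz0 : 0 < ‖z‖ := by linarith
  have he : ‖‖z‖⁻¹ • z‖ = 1 := by rw [norm_smul, norm_inv, norm_norm, inv_mul_cancel₀ hz0.ne']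
  refine (sphereLaw_le_ballMeasure hm (measurableSet_le (by fun_prop) measurable_const) ?_).trans
    (ballMeasure_halfSpace_le hm he)
  rintro u hu - r ⟨hr0, hr1⟩
  rw [Set.mem_ofPred_eq] at hu ⊢
  rw [inner_smul_left, inner_smul_right, conj_trivial, ← div_eq_inv_mul, ← mul_div_assoc,
    div_le_iff₀ hz0]
  have h1 : 1 / (18 * (m : ℝ)) = 2 * (1 / (36 * m)) := by field_simp; norm_num
  have h2 : 0 < 1 / (36 * (m : ℝ)) := by positivity
  rw [h1]
  rcases le_or_gt (inner ℝ u z) 0 with h | h <;> nlinarith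

/-- The points of the cube `[-1, 1]^m` whose coordinates are multiples of `1 / M`. -/
noncomputable def gridPoint {M : ℕ} (g : Fin m → Fin (2 * M + 1)) : Euc m :=
  WithLp.toLp 2 fun k => ((g k : ℝ) - M) / M

/-- Each coordinate is rounded down to a multiple of 1/M; the m errors are simply added. -/
theorem exists_gridPoint_near {M : ℕ} (hM : 0 < M) {x : Euc m} (hx : ‖x‖ = 1) :
    ∃ g : Fin m → Fin (2 * M + 1), ‖x - gridPoint g‖ ≤ m / M := by
  have hM0 : (0 : ℝ) < M := by exact_mod_cast hM
  have hk : ∀ k, |x k| ≤ 1 := fun k => by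
    have := PiLp.norm_apply_le x k
    rwa [hx] at this
  have hfl : ∀ k, -(M : ℤ) ≤ ⌊M * x k⌋ ∧ ⌊M * x k⌋ ≤ M := fun k => by
    have := abs_le.1 (hk k)
    constructor
    · rw [Int.le_floor]; push_cast; nlinarith
    · have h1 := Int.floor_le (M * x k)
      have : (⌊M * x k⌋ : ℝ) ≤ M := by nlinarith
      exact_mod_cast this
  refine ⟨fun k => ⟨(⌊M * x k⌋ + M).toNat, by have := hfl k; omega⟩, ?_⟩
  set z : Euc m := gridPoint fun k => (⟨(⌊M * x k⌋ + M).toNat, by have := hfl k; omega⟩ :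
    Fin (2 * M + 1)) with hz
  have hzk : ∀ k, z k = ⌊M * x k⌋ / M := fun k => by
    have h1 : (((⌊M * x k⌋ + M).toNat : ℤ) : ℝ) = ⌊M * x k⌋ + M := by
      rw [Int.toNat_of_nonneg (by have := hfl k; omega)]
      push_cast; rfl
    rw [Int.cast_natCast] at h1
    simp [hz, gridPoint, h1]
  have hd : ∀ k, |(x - z) k| ≤ 1 / M := fun k => by
    rw [PiLp.sub_apply, hzk, abs_le]
    have h1 := Int.floor_le (M * x k)
    have h2 := Int.lt_floor_add_one (M * x k)
    have h3 : x k - ⌊M * x k⌋ / M = (M * x k - ⌊M * x k⌋) / M := by field_simp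
    rw [h3]
    constructor
    · exact le_trans (by rw [neg_nonpos]; positivity) (div_nonneg (by linarith) hM0.le)
    · gcongr; linarith
  calc ‖x - z‖ = ‖∑ k, EuclideanSpace.single k ((x - z) k)‖ := by
        congr 1
        ext j
        simp [Finset.sum_apply]
    _ ≤ ∑ k, ‖EuclideanSpace.single k ((x - z) k)‖ := norm_sum_le _ _
    _ ≤ ∑ _k : Fin m, 1 / (M : ℝ) := by
        gcongr with k
        rw [PiLp.norm_single]
        exact hd k
    _ = m / M := by simp [div_eq_mul_inv]

/-- Many rows are infeasible with a large margin, up to an event of small probability. -/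
theorem exists_covering_event (hm : 1 ≤ m) (n : ℕ) :
    ∃ S : Set (Fin n → Euc m), MeasurableSet S ∧
      rowsLaw m n S ≤ ENNReal.ofReal ((145 * m ^ 2) ^ m * (3 / 4) ^ n) ∧
      ∀ a, (∀ i, ‖a i‖ = 1) → a ∉ S → ∀ x : Euc m, ‖x‖ = 1 →
        ∃ i, 1 / (72 * m) ≤ inner ℝ (a i) x := by
  have := isProbabilityMeasure_sphereLaw hm
  have hm0 : (0 : ℝ) < m := by exact_mod_cast hm
  have hm1 : (1 : ℝ) ≤ m := by exact_mod_cast hm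
  -- Makes the rounding error m/M = 1/(72m): if all rows are below 1/(72m) at `x`, they are at most
  -- 1/(36m) at the grid point. The net has (2M + 1)^m ≤ (145m²)^m points.
  set M := 72 * m ^ 2 with hM
  have hM0 : 0 < M := by positivity
  have hMm : (m : ℝ) / M = 1 / (72 * m) := by rw [hM]; push_cast; field_simp
  let S : (Fin m → Fin (2 * M + 1)) → Set (Fin n → Euc m) := fun g =>
    {a | 1 / 2 ≤ ‖gridPoint g‖ ∧ ∀ i, inner ℝ (a i) (gridPoint g) ≤ 1 / (36 * m)}
  have hpi : ∀ g : Fin m → Fin (2 * M + 1), {a : Fin n → Euc m | ∀ i, inner ℝ (a i) (gridPoint g) ≤ 1 / (36 * (m : ℝ))} =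
      Set.univ.pi fun _ => {u | inner ℝ u (gridPoint g) ≤ 1 / (36 * (m : ℝ))} := fun g => by
    ext a; simp
  have hm' : ∀ g : Fin m → Fin (2 * M + 1),
      MeasurableSet {u | inner ℝ u (gridPoint g) ≤ 1 / (36 * (m : ℝ))} := fun g =>
    measurableSet_le (by fun_prop) measurable_const
  refine ⟨⋃ g, S g, MeasurableSet.iUnion fun g => ?_, ?_, ?_⟩
  · refine (MeasurableSet.const _).inter ?_
    have := MeasurableSet.univ_pi fun _ : Fin n => hm' g
    rwa [← hpi] at this
  · calc rowsLaw m n (⋃ g, S g) ≤ ∑ g, rowsLaw m n (S g) := measure_iUnion_fintype_le _ _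
      _ ≤ ∑ _g : Fin m → Fin (2 * M + 1), ENNReal.ofReal ((3 / 4) ^ n) := by
          gcongr with g
          by_cases hg : 1 / 2 ≤ ‖gridPoint g‖
          · have h1 : S g = Set.univ.pi fun _ =>
                {u | inner ℝ u (gridPoint g) ≤ 1 / (36 * (m : ℝ))} := by
              rw [← hpi]
              exact Set.ext fun a => and_iff_right hg
            rw [h1, rowsLaw, Measure.pi_pi, Finset.prod_const, Finset.card_univ, Fintype.card_fin,
              ENNReal.ofReal_pow (by norm_num)]
            gcongr
            exact sphereLaw_inner_le_le hm hg
          · have h1 : S g = ∅ := by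
              ext a
              simp only [S, hg, false_and, Set.mem_ofPred_eq, Set.mem_empty_iff_false]
            rw [h1, measure_empty]
            exact zero_le
      _ = ENNReal.ofReal ((2 * M + 1) ^ m * (3 / 4) ^ n) := by
          rw [Finset.sum_const, Finset.card_univ, Fintype.card_fun, Fintype.card_fin,
            Fintype.card_fin, nsmul_eq_mul, ← ENNReal.ofReal_natCast,
            ← ENNReal.ofReal_mul (by positivity)]
          push_cast; rfl
      _ ≤ _ := by
          refine ENNReal.ofReal_le_ofReal ?_
          gcongr
          rw [hM]
          push_cast
          nlinarith
  · intro a ha haS x hx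
    by_contra! hcon
    obtain ⟨g, hg⟩ := exists_gridPoint_near hM0 hx
    rw [hMm] at hg
    have h72 : 1 / (72 * (m : ℝ)) ≤ 1 / 2 := by
      gcongr
      linarith
    refine haS (Set.mem_iUnion.2 ⟨g, ?_, fun i => ?_⟩)
    · have := norm_sub_norm_le x (gridPoint g)
      rw [hx] at this
      linarith
    · have h1 : inner ℝ (a i) (gridPoint g) = inner ℝ (a i) x - inner ℝ (a i) (x - gridPoint g) := by
        rw [inner_sub_right]; ring
      have h2 := abs_real_inner_le_norm (a i) (x - gridPoint g)
      rw [ha, one_mul] at h2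
      have h3 : 1 / (36 * (m : ℝ)) = 1 / (72 * m) + 1 / (72 * m) := by field_simp; norm_num
      rw [h1, h3]
      linarith [hcon i, neg_abs_le (inner ℝ (a i) (x - gridPoint g))]

end Covering

/-! ### Expectations and the asymptotic bound. -/

section Expectation

theorem le_tsum_indicator_natCast_lt (x : ℝ≥0∞) :
    x ≤ ∑' k : ℕ, if (k : ℝ≥0∞) < x then 1 else 0 := by
  have hsum : ∀ N : ℕ, (∀ k < N, (k : ℝ≥0∞) < x) →
      (N : ℝ≥0∞) ≤ ∑' k : ℕ, if (k : ℝ≥0∞) < x then 1 else 0 := by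
    intro N hN
    refine le_trans (le_of_eq ?_) (ENNReal.sum_le_tsum (Finset.range N))
    rw [Finset.sum_congr rfl fun k hk => if_pos (hN k (Finset.mem_range.1 hk))]
    simp
  by_cases hx : x = ⊤
  · subst hx
    simp
  · lift x to NNReal using hx
    have h1 : (x : ℝ≥0∞) ≤ (⌈x⌉₊ : ℝ≥0∞) := by exact_mod_cast Nat.le_ceil x
    have hlt : ∀ k < ⌈x⌉₊, ((k : ℕ) : ℝ≥0∞) < (x : ℝ≥0∞) := fun k hk => by
      exact_mod_cast Nat.lt_ceil.1 hk
    refine h1.trans (hsum _ hlt)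

/-- The integral over `S` of a function with an exponential tail. -/
theorem setLIntegral_le_of_exp_tail {X : Type*} [MeasurableSpace X] {μ : Measure X}
    {f : X → ℝ≥0∞} (hf : AEMeasurable f μ) {Q : ℝ} (hQ : 1 ≤ Q)
    (h : ∀ τ : ℝ, μ {a | ENNReal.ofReal τ < f a} ≤ ENNReal.ofReal (Q * Real.exp (-τ / 2)))
    (S : Set X) :
    ∫⁻ a in S, f a ∂μ ≤ ENNReal.ofReal (2 * Real.log Q) * μ S + 3 := by
  have hQ0 : 0 < Q := by linarith
  -- At level L the tail bound equals 1; beyond it, unit steps give a geometric series of ratio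
  -- exp(-1/2) ≤ 2/3, with sum at most 3.
  set L := 2 * Real.log Q with hL
  have hL0 : 0 ≤ L := by have := Real.log_nonneg hQ; positivity
  have hpt : ∀ a, f a ≤ ENNReal.ofReal L +
      ∑' k : ℕ, {a | ENNReal.ofReal (L + k) < f a}.indicator (fun _ => (1 : ℝ≥0∞)) a := by
    intro a
    refine (le_add_tsub (a := f a) (b := ENNReal.ofReal L)).trans (add_le_add le_rfl ?_)
    refine (le_tsum_indicator_natCast_lt _).trans (ENNReal.tsum_le_tsum fun k => ?_)
    by_cases hk : (k : ℝ≥0∞) < f a - ENNReal.ofReal L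
    · rw [if_pos hk, Set.indicator_of_mem]
      rw [Set.mem_ofPred_eq, ENNReal.ofReal_add hL0 (Nat.cast_nonneg k), ENNReal.ofReal_natCast]
      rw [lt_tsub_iff_left] at hk
      exact hk
    · rw [if_neg hk]
      exact zero_le
  have hgeo : ∑' k : ℕ, ENNReal.ofReal (Q * Real.exp (-(L + k) / 2)) ≤ 3 := by
    have h1 : ∀ k : ℕ, ENNReal.ofReal (Q * Real.exp (-(L + k) / 2)) ≤ ENNReal.ofReal (2 / 3) ^ k := by
      intro k
      rw [← ENNReal.ofReal_pow (by norm_num)]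
      refine ENNReal.ofReal_le_ofReal ?_
      have h2 : Real.exp (-(L + k) / 2) = Q⁻¹ * Real.exp (-(1 / 2)) ^ k := by
        rw [← Real.exp_nat_mul, show -(L + k) / 2 = -Real.log Q + k * -(1 / 2) by rw [hL]; ring,
          Real.exp_add, Real.exp_neg, Real.exp_log hQ0]
      rw [h2, mul_inv_cancel_left₀ hQ0.ne']
      gcongr
      rw [Real.exp_neg, inv_le_comm₀ (Real.exp_pos _) (by norm_num)]
      linarith [Real.add_one_le_exp (1 / 2 : ℝ)]
    refine (ENNReal.tsum_le_tsum h1).trans_eq ?_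
    rw [ENNReal.tsum_geometric, ← ENNReal.ofReal_one, ← ENNReal.ofReal_sub _ (by norm_num),
      ← ENNReal.ofReal_inv_of_pos (by norm_num)]
    norm_num
  calc ∫⁻ a in S, f a ∂μ
      ≤ ∫⁻ a in S, (ENNReal.ofReal L + ∑' k : ℕ,
        {a | ENNReal.ofReal (L + k) < f a}.indicator (fun _ => (1 : ℝ≥0∞)) a) ∂μ :=
        lintegral_mono hpt
    _ = ENNReal.ofReal L * μ S + ∑' k : ℕ, ∫⁻ a in S,
        {a | ENNReal.ofReal (L + k) < f a}.indicator (fun _ => (1 : ℝ≥0∞)) a ∂μ := by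
        rw [lintegral_add_left measurable_const, lintegral_const, Measure.restrict_apply_univ,
          lintegral_tsum fun k => ?_]
        exact aemeasurable_const.indicator₀
          (nullMeasurableSet_lt aemeasurable_const hf.restrict)
    _ ≤ ENNReal.ofReal L * μ S + ∑' k : ℕ, ENNReal.ofReal (Q * Real.exp (-(L + k) / 2)) := by
        gcongr with k
        refine (setLIntegral_le_lintegral _ _).trans ((lintegral_indicator_const_le _ _).trans ?_)
        rw [one_mul]
        exact h _
    _ ≤ _ := by gcongr

variable {m n : ℕ}

theorem aemeasurable_logConditionNumber_rowsMatrix (hm : 1 ≤ m) (hn : 1 ≤ n)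
    (μ : Measure (Fin n → Euc m)) :
    AEMeasurable (fun a => logConditionNumber (rowsMatrix a)) μ :=
  aemeasurable_logConditionNumber hm hn fun i => (measurable_pi_apply i).aemeasurable

theorem setLIntegral_logConditionNumber_le (hm : 1 ≤ m) (hmn : m ≤ n) (S : Set (Fin n → Euc m)) :
    ∫⁻ a in S, logConditionNumber (rowsMatrix a) ∂(rowsLaw m n) ≤
      ENNReal.ofReal (2 * Real.log (54 * n ^ 6)) * rowsLaw m n S + 3 := by
  have hn1 : (1 : ℝ) ≤ n := by exact_mod_cast hm.trans hmn
  refine setLIntegral_le_of_exp_tail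
    (aemeasurable_logConditionNumber_rowsMatrix hm (hm.trans hmn) _) ?_
    (rowsLaw_lt_logConditionNumber_le hm hmn) S
  linarith [one_le_pow₀ hn1 (n := 6)]

theorem lintegral_logConditionNumber_le (hm : 1 ≤ m) (hmn : m ≤ n) :
    ∫⁻ a, logConditionNumber (rowsMatrix a) ∂(rowsLaw m n) ≤
      ENNReal.ofReal (2 * Real.log (54 * n ^ 6)) + 3 := by
  have := isProbabilityMeasure_rowsLaw hm n
  simpa using setLIntegral_logConditionNumber_le hm hmn Set.univ

theorem lintegral_logConditionNumber_le_of_covering (hm : 1 ≤ m) (hmn : m ≤ n) :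
    ∫⁻ a, logConditionNumber (rowsMatrix a) ∂(rowsLaw m n) ≤
      ENNReal.ofReal (2 * Real.log (54 * n ^ 6)) *
        ENNReal.ofReal ((145 * m ^ 2) ^ m * (3 / 4) ^ n) + 3 + ENNReal.ofReal (Real.log (72 * m)) := by
  have := isProbabilityMeasure_rowsLaw hm n
  have hm0 : (0 : ℝ) < m := by exact_mod_cast hm
  obtain ⟨S, hSm, hS, hSc⟩ := exists_covering_event hm n
  rw [← lintegral_add_compl _ hSm]
  refine add_le_add ((setLIntegral_logConditionNumber_le hm hmn S).trans (by gcongr)) ?_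
  calc ∫⁻ a in Sᶜ, logConditionNumber (rowsMatrix a) ∂(rowsLaw m n)
      ≤ ∫⁻ _a in Sᶜ, ENNReal.ofReal (Real.log (72 * m)) ∂(rowsLaw m n) := by
        refine lintegral_mono_ae ?_
        filter_upwards [ae_restrict_of_ae (ae_norm_eq_one hm n), ae_restrict_mem hSm.compl]
          with a ha haS
        refine logConditionNumber_le_of_margin hm (hm.trans hmn) ha (Or.inr fun x hx => ?_)
        rw [Real.exp_neg, Real.exp_log (by positivity), ← one_div]
        exact hSc a ha haS x hx
    _ ≤ _ := by
        rw [lintegral_const]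
        rw [Measure.restrict_apply_univ]
        exact mul_le_of_le_one_right' prob_le_one

theorem IsUniformRandomMatrix.expectedLogConditionNumber_eq {Ω : Type*} [MeasurableSpace Ω]
    {P : Measure Ω} [IsProbabilityMeasure P] {A : Ω → Matrix (Fin n) (Fin m) ℝ}
    (hA : IsUniformRandomMatrix A P) (hm : 1 ≤ m) (hn : 1 ≤ n) :
    expectedLogConditionNumber A P =
      ∫⁻ a, logConditionNumber (rowsMatrix a) ∂(rowsLaw m n) := by
  have := isProbabilityMeasure_sphereLaw hm
  have h : HasLaw (fun ω i => rowVec (A ω) i) (rowsLaw m n) P :=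
    hA.indep_rows.hasLaw_pi hA.hasLaw_row
  rw [← h.map_eq, lintegral_map' (aemeasurable_logConditionNumber_rowsMatrix hm hn _) h.aemeasurable]
  rfl

/-- For large `m`, the expectation is bounded by a multiple of `log m`, uniformly in `n`. -/
theorem eventually_lintegral_logConditionNumber_le :
    ∀ᶠ m : ℕ in atTop, ∀ n, m ≤ n →
      ∫⁻ a, logConditionNumber (rowsMatrix a) ∂(rowsLaw m n) ≤
        ENNReal.ofReal (2 * Real.log (54 * m ^ 18) + Real.log (72 * m) + 4) := by
  have h1 : ∀ᶠ m : ℕ in atTop, 145 * ((m ^ 2 : ℕ) : ℝ) ≤ (7 / 6) ^ (m ^ 2) := by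
    have ht := (tendsto_pow_const_mul_const_pow_of_abs_lt_one 1
      (by norm_num [abs_lt] : |(6 / 7 : ℝ)| < 1)).comp (tendsto_pow_atTop (α := ℕ) two_ne_zero)
    filter_upwards [ht.eventually_le_const (by norm_num : (0 : ℝ) < 1 / 145)] with m hm
    simp only [Function.comp_apply, pow_one] at hm
    rw [show (6 / 7 : ℝ) = (7 / 6)⁻¹ by norm_num, inv_pow, ← div_eq_mul_inv,
      div_le_iff₀ (by positivity)] at hm
    linarith
  have h2 : ∀ᶠ N : ℕ in atTop, ∀ n ≥ N, 108 * (n : ℝ) ^ 6 * (7 / 8) ^ n ≤ 1 := by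
    have ht := tendsto_pow_const_mul_const_pow_of_abs_lt_one 6
      (by norm_num [abs_lt] : |(7 / 8 : ℝ)| < 1)
    have h3 := ht.eventually_le_const (by norm_num : (0 : ℝ) < 1 / 108)
    filter_upwards [eventually_forall_ge_atTop.2 h3] with N hN n hn
    linarith [hN n hn]
  filter_upwards [h1, h2, eventually_ge_atTop 1] with m h1 h2 hm n hmn
  have hm1 : (1 : ℝ) ≤ m := by exact_mod_cast hm
  have hn1 : (1 : ℝ) ≤ n := by exact_mod_cast hm.trans hmn
  have hl1 : 0 ≤ Real.log (72 * (m : ℝ)) := Real.log_nonneg (by linarith)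
  have hl2 : 0 ≤ Real.log (54 * (m : ℝ) ^ 18) :=
    Real.log_nonneg (by linarith [one_le_pow₀ hm1 (n := 18)])
  have hl3 : 0 ≤ Real.log (54 * (n : ℝ) ^ 6) :=
    Real.log_nonneg (by linarith [one_le_pow₀ hn1 (n := 6)])
  have h3 : (3 : ℝ≥0∞) = ENNReal.ofReal 3 := by simp
  -- For n ≤ m³ the tail bound is already O(log m). For n ≥ m³ the net size is at most (7/6)^n, so
  -- the exceptional probability is at most (7/6 · 3/4)^n = (7/8)^n, which beats the logarithmic
  -- factor.
  rcases le_total n (m ^ 3) with hnm | hnm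
  · refine (lintegral_logConditionNumber_le hm hmn).trans ?_
    rw [h3, ← ENNReal.ofReal_add (by positivity) (by norm_num)]
    refine ENNReal.ofReal_le_ofReal ?_
    have h4 : (n : ℝ) ^ 6 ≤ m ^ 18 := by
      calc (n : ℝ) ^ 6 ≤ ((m : ℝ) ^ 3) ^ 6 := by gcongr; exact_mod_cast hnm
        _ = _ := by ring
    have h5 : Real.log (54 * (n : ℝ) ^ 6) ≤ Real.log (54 * (m : ℝ) ^ 18) :=
      Real.log_le_log (by positivity) (by gcongr)
    linarith
  · refine (lintegral_logConditionNumber_le_of_covering hm hmn).trans ?_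
    rw [h3, ← ENNReal.ofReal_mul (by positivity), ← ENNReal.ofReal_add (by positivity)
      (by norm_num), ← ENNReal.ofReal_add (by positivity) hl1]
    refine ENNReal.ofReal_le_ofReal ?_
    have h4 : (145 * (m : ℝ) ^ 2) ^ m ≤ (7 / 6) ^ n := by
      calc (145 * (m : ℝ) ^ 2) ^ m ≤ ((7 / 6) ^ (m ^ 2)) ^ m := by
            gcongr
            exact_mod_cast h1
        _ = (7 / 6) ^ (m ^ 3) := by rw [← pow_mul]; rfl
        _ ≤ _ := pow_le_pow_right₀ (by norm_num) hnm
    have h5 : (145 * (m : ℝ) ^ 2) ^ m * (3 / 4) ^ n ≤ (7 / 8) ^ n := by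
      calc _ ≤ (7 / 6 : ℝ) ^ n * (3 / 4) ^ n := by gcongr
        _ = _ := by rw [← mul_pow]; norm_num
    have h6 : 2 * Real.log (54 * (n : ℝ) ^ 6) ≤ 108 * n ^ 6 := by
      linarith [Real.log_le_self (by positivity : 0 ≤ 54 * (n : ℝ) ^ 6)]
    have h7 : 2 * Real.log (54 * (n : ℝ) ^ 6) * ((145 * (m : ℝ) ^ 2) ^ m * (3 / 4) ^ n) ≤ 1 :=
      (by gcongr : _ ≤ 108 * (n : ℝ) ^ 6 * (7 / 8) ^ n).trans (h2 n hmn)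
    linarith

theorem eventually_log_bound_le :
    ∀ᶠ m : ℕ in atTop,
      2 * Real.log (54 * m ^ 18) + Real.log (72 * m) + 4 ≤ Real.log 2 * (m : ℝ) := by
  have hlog2 : 0 < Real.log 2 := Real.log_pos one_lt_two
  -- The left side contains (2·18 + 1) log m = 37 log m, so the constant log 2/74 uses half of the
  -- available log 2 · m; the constants take the other half.
  have h1 := (Real.isLittleO_log_id_atTop.comp_tendsto
    (tendsto_natCast_atTop_atTop (R := ℝ))).bound (by positivity : 0 < Real.log 2 / 74)
  have h2 := tendsto_natCast_atTop_atTop (R := ℝ) |>.eventually_ge_atTop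
    ((2 * Real.log 54 + Real.log 72 + 4) / (Real.log 2 / 2))
  filter_upwards [h1, h2, eventually_ge_atTop 1] with m h1 h2 hm
  have hm0 : (0 : ℝ) < m := by exact_mod_cast hm
  rw [div_le_iff₀ (by positivity)] at h2
  simp only [Function.comp_apply, id, Real.norm_eq_abs, Nat.abs_cast] at h1
  have h3 := (le_abs_self _).trans h1
  rw [Real.log_mul (by norm_num) (by positivity), Real.log_mul (by norm_num) hm0.ne', Real.log_pow]
  push_cast
  linarith

end Expectation

end LinearFeasibility

theorem mainTheorem4 {Ω : ℕ → ℕ → Type*} [∀ m n, MeasurableSpace (Ω m n)]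
    (P : ∀ m n, Measure (Ω m n)) [∀ m n, IsProbabilityMeasure (P m n)]
    (A : ∀ m n, Ω m n → Matrix (Fin n) (Fin m) ℝ)
    (hA : ∀ m n, 1 ≤ m → m ≤ n → LinearFeasibility.IsUniformRandomMatrix (A m n) (P m n)) :
    limsup (fun m : ℕ => ⨆ (n : ℕ) (_ : m ≤ n),
      LinearFeasibility.expectedLogConditionNumber (A m n) (P m n) / (m : ℝ≥0∞)) atTop
      ≤ ENNReal.ofReal (Real.log 2) := by
  refine limsup_le_of_le ?_ ?_
  · isBoundedDefault
  filter_upwards [LinearFeasibility.eventually_lintegral_logConditionNumber_le,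
    LinearFeasibility.eventually_log_bound_le, eventually_ge_atTop 1] with m h1 h2 hm
  refine iSup₂_le fun n hmn => ENNReal.div_le_of_le_mul ?_
  rw [(hA m n hm hmn).expectedLogConditionNumber_eq hm (hm.trans hmn), ← ENNReal.ofReal_natCast,
    ← ENNReal.ofReal_mul (Real.log_nonneg one_le_two)]
  exact (h1 n hmn).trans (ENNReal.ofReal_le_ofReal h2)
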